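/- Edge-ordered graphs are finite simple graphs together with a total order of the edge set. An embedding of an edge-ordered graph $F$ into an edge-ordered graph $H$ is an injective map $\varphi:V(F)\to V(H)$ that maps edges to edges and satisfies $\varphi(u)\varphi(v)<\varphi(w)\varphi(z)$ whenever $uv<wz$ in $F$; its image is a copy of $F$ in $H$. Call $F$ *Turánable* if there is a positive integer $t$ such that every edge-ordering of $K_t$ contains a copy of $F$. Call $F$ *tileable* if there is a positive integer $t$ divisible by $|V(F)|$ such that every edge-ordering of $K_t$ contains a perfect $F$-tiling, i.e. a collection of vertex-disjoint copies of $F$ that covers all vertices of $K_t$. On the vertex set $\{v_1,\dots,v_n\}$ of $K_n$, the *min ordering* is the edge-ordering in which $v_iv_j$ ($i<j$) has label $2ni+j-1$, and the *max ordering* is the one in which $v_iv_j$ ($i<j$) has label $(2n-1)j+i$; edges are ordered by increasing label. Let $f=|V(F)|$. A vertex of $F$ is *minimal* if some embedding of $F$ into the min ordering of $K_f$ maps it to $v_1$, and *maximal* if some embedding of $F$ into the max ordering of $K_f$ maps it to $v_f$. **Proposition.** Let $F$ be a Turánable edge-ordered graph, and let $\underline v\neq\overline v$ be non-isolated vertices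 of $F$ such that $\underline v$ is minimal and $\overline v$ is maximal. Let $F'$ be the edge-ordered graph obtained from $F$ by adding two new vertices $\underline u,\overline u$ and the edges $\underline u\,\underline v$ and $\overline u\,\overline v$, where $\underline u\,\underline v$ is smaller than all other edges of $F'$, $\overline u\,\overline v$ is larger than all other edges of $F'$, and the edges of $F$ keep their order. Then $F'$ is tileable. -/

import Mathlib

/-- A graph on the vertex type `V` together with a total order of its edge set. -/
structure EdgeOrderedGraph (V : Type*) where
  /-- The underlying (simple, unordered) graph. -/
  graph : SimpleGraph V
  /-- The total order of the edges. -/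
  edgeOrder : LinearOrder graph.edgeSet

namespace EdgeOrderedGraph

universe u v

/-- `F.EdgeLT e e'`: the edge `e` is smaller than the edge `e'` in the edge-ordered graph `F`. -/
def EdgeLT {V : Type u} (F : EdgeOrderedGraph V) (e e' : F.graph.edgeSet) : Prop :=
  F.edgeOrder.lt e e'

/-- An embedding of the edge-ordered graph `F` into the edge-ordered graph `H`: an injective map on
the vertices which maps edges to edges and preserves the order of the edges. -/
structure Embedding {V : Type u} {W : Type v} (F : EdgeOrderedGraph V)
    (H : EdgeOrderedGraph W) where
  /-- The underlying injective graph homomorphism. -/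
  toCopy : SimpleGraph.Copy F.graph H.graph
  edgeLT_map : ∀ e e' : F.graph.edgeSet, F.EdgeLT e e' →
    H.EdgeLT (toCopy.mapEdgeSet e) (toCopy.mapEdgeSet e')

/-- The set of vertices covered by the copy of `F` given by an embedding. -/
def Embedding.vertexSet {V : Type u} {W : Type v} {F : EdgeOrderedGraph V}
    {H : EdgeOrderedGraph W} (φ : Embedding F H) : Set W :=
  Set.range (fun x : V => φ.toCopy x)

/-- `H` contains a copy of `F`. -/
def ContainsCopy {V : Type u} {W : Type v} (H : EdgeOrderedGraph W)
    (F : EdgeOrderedGraph V) : Prop :=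
  Nonempty (Embedding F H)

/-- An `F`-tiling in `H`: a collection of vertex-disjoint copies of `F` in `H`. -/
def IsTiling {V : Type u} {W : Type v} {F : EdgeOrderedGraph V} {H : EdgeOrderedGraph W}
    (T : Set (Embedding F H)) : Prop :=
  T.PairwiseDisjoint Embedding.vertexSet

/-- `H` contains a perfect `F`-tiling, that is, an `F`-tiling covering all the vertices of `H`. -/
def HasPerfectTiling {V : Type u} {W : Type v} (H : EdgeOrderedGraph W)
    (F : EdgeOrderedGraph V) : Prop :=
  ∃ T : Set (Embedding F H), IsTiling T ∧ ∀ w : W, ∃ φ ∈ T, w ∈ φ.vertexSet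

/-- The complete graph `K_t` (on the vertex set `Fin t`) with a given edge-ordering. -/
def complete (t : ℕ) (o : LinearOrder (⊤ : SimpleGraph (Fin t)).edgeSet) :
    EdgeOrderedGraph (Fin t) :=
  ⟨⊤, o⟩

/-- `F` is Turánable: for some positive `t`, every edge-ordering of `K_t` contains a copy
of `F`. -/
def Turanable {V : Type u} (F : EdgeOrderedGraph V) : Prop :=
  ∃ t : ℕ, 0 < t ∧ ∀ o : LinearOrder (⊤ : SimpleGraph (Fin t)).edgeSet,
    (complete t o).ContainsCopy F

/-- `F` is tileable: for some positive `t` divisible by the number of vertices of `F`, every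
edge-ordering of `K_t` contains a perfect `F`-tiling. -/
def Tileable {V : Type u} [Fintype V] (F : EdgeOrderedGraph V) : Prop :=
  ∃ t : ℕ, 0 < t ∧ Fintype.card V ∣ t ∧
    ∀ o : LinearOrder (⊤ : SimpleGraph (Fin t)).edgeSet, (complete t o).HasPerfectTiling F

/-! ### The min ordering and the max ordering of `K_n`

The vertices `v_1, …, v_n` of `K_n` are the elements `0, …, n - 1` of `Fin n`, in this order. For an
edge `e = v_i v_j` with `i < j` we have `i = e.inf + 1` and `j = e.sup + 1`. -/

/-- The label `2 n i + j - 1` of the edge `v_i v_j`, `i < j`. -/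
def minLabel (n : ℕ) (e : Sym2 (Fin n)) : ℤ :=
  2 * (n : ℤ) * (((e.inf : Fin n) : ℤ) + 1) + (((e.sup : Fin n) : ℤ) + 1) - 1

/-- The label `(2 n - 1) j + i` of the edge `v_i v_j`, `i < j`. -/
def maxLabel (n : ℕ) (e : Sym2 (Fin n)) : ℤ :=
  (2 * (n : ℤ) - 1) * (((e.sup : Fin n) : ℤ) + 1) + (((e.inf : Fin n) : ℤ) + 1)

theorem minLabel_injective (n : ℕ) : Function.Injective (minLabel n) := by
  intro e e' h
  unfold minLabel at h
  have h1 := e.inf.isLt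
  have h2 := e.sup.isLt
  have h3 := e'.inf.isLt
  have h4 := e'.sup.isLt
  have key : ((e.inf : Fin n) : ℤ) = ((e'.inf : Fin n) : ℤ) := by
    rcases lt_trichotomy ((e.inf : Fin n) : ℤ) ((e'.inf : Fin n) : ℤ) with hlt | heq | hlt
    · nlinarith
    · exact heq
    · nlinarith
  rw [key] at h
  refine Sym2.inf_eq_inf_and_sup_eq_sup.1 ⟨Fin.ext ?_, Fin.ext ?_⟩
  · exact_mod_cast key
  · omega

theorem maxLabel_injective (n : ℕ) : Function.Injective (maxLabel n) := by
  intro e e' h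
  unfold maxLabel at h
  have h1 := e.inf.isLt
  have h2 := e.sup.isLt
  have h3 := e'.inf.isLt
  have h4 := e'.sup.isLt
  have key : ((e.sup : Fin n) : ℤ) = ((e'.sup : Fin n) : ℤ) := by
    rcases lt_trichotomy ((e.sup : Fin n) : ℤ) ((e'.sup : Fin n) : ℤ) with hlt | heq | hlt
    · nlinarith
    · exact heq
    · nlinarith
  rw [key] at h
  refine Sym2.inf_eq_inf_and_sup_eq_sup.1 ⟨Fin.ext ?_, Fin.ext ?_⟩
  · omega
  · exact_mod_cast key

/-- The min ordering of `K_n`, induced by the labeling `minLabel`. -/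
def minOrdering (n : ℕ) : EdgeOrderedGraph (Fin n) :=
  complete n (LinearOrder.lift' (fun e => minLabel n e.1)
    ((minLabel_injective n).comp Subtype.val_injective))

/-- The max ordering of `K_n`, induced by the labeling `maxLabel`. -/
def maxOrdering (n : ℕ) : EdgeOrderedGraph (Fin n) :=
  complete n (LinearOrder.lift' (fun e => maxLabel n e.1)
    ((maxLabel_injective n).comp Subtype.val_injective))

/-- `x` is a minimal vertex of `F`: writing `f` for the number of vertices of `F`, the vertex `x`
plays the role of `v_1` in some embedding of `F` into the min ordering of `K_f`. -/
def IsMinimalVertex {V : Type u} [Fintype V] (F : EdgeOrderedGraph V) (x : V) : Prop :=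
  ∃ φ : Embedding F (minOrdering (Fintype.card V)), (φ.toCopy x).val = 0

/-- `x` is a maximal vertex of `F`: writing `f` for the number of vertices of `F`, the vertex `x`
plays the role of `v_f` in some embedding of `F` into the max ordering of `K_f`. -/
def IsMaximalVertex {V : Type u} [Fintype V] (F : EdgeOrderedGraph V) (x : V) : Prop :=
  ∃ φ : Embedding F (maxOrdering (Fintype.card V)), (φ.toCopy x).val + 1 = Fintype.card V

/-! ### Adding a smallest and a largest pendant edge

The new vertex set is `V ⊕ Bool`; the old vertices are `Sum.inl y` and the two new vertices are
`Sum.inr false` and `Sum.inr true`. -/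

/-- The new edge that joins the new vertex `Sum.inr false` to the old vertex `a`. -/
def lowEdge {V : Type u} (a : V) : Sym2 (V ⊕ Bool) := s(Sum.inr false, Sum.inl a)

/-- The new edge that joins the new vertex `Sum.inr true` to the old vertex `b`. -/
def highEdge {V : Type u} (b : V) : Sym2 (V ⊕ Bool) := s(Sum.inr true, Sum.inl b)

/-- The edge `e` of the old graph, as an edge of the new graph. -/
def oldEdge {V : Type u} (e : Sym2 V) : Sym2 (V ⊕ Bool) := e.map Sum.inl

/-- The graph obtained from `G` by adding two new vertices, one joined only to `a` and the other
joined only to `b`. -/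
def addPendantsGraph {V : Type u} (G : SimpleGraph V) (a b : V) : SimpleGraph (V ⊕ Bool) :=
  SimpleGraph.fromEdgeSet (oldEdge '' G.edgeSet ∪ {lowEdge a, highEdge b})

/-- The order of the edges of the new graph: `lowEdge a` is smaller than all other edges,
`highEdge b` is larger than all other edges, and the old edges are ordered as in `F`. -/
def addPendantsLT {V : Type u} (F : EdgeOrderedGraph V) (a b : V)
    (e e' : (addPendantsGraph F.graph a b).edgeSet) : Prop :=
  (e.1 = lowEdge a ∧ e'.1 ≠ lowEdge a) ∨
  (e.1 ≠ highEdge b ∧ e'.1 = highEdge b) ∨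
  ∃ d d' : F.graph.edgeSet, F.EdgeLT d d' ∧ e.1 = oldEdge d.1 ∧ e'.1 = oldEdge d'.1

theorem oldEdge_injective {V : Type u} : Function.Injective (oldEdge (V := V)) :=
  Sym2.map.injective Sum.inl_injective

theorem oldEdge_ne_lowEdge {V : Type u} (e : Sym2 V) (a : V) : oldEdge e ≠ lowEdge a := by
  induction e using Sym2.ind
  simp [oldEdge, lowEdge]

theorem oldEdge_ne_highEdge {V : Type u} (e : Sym2 V) (b : V) : oldEdge e ≠ highEdge b := by
  induction e using Sym2.ind
  simp [oldEdge, highEdge]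

theorem lowEdge_ne_highEdge {V : Type u} (a b : V) : lowEdge a ≠ highEdge b := by
  simp [lowEdge, highEdge]

theorem mem_edgeSet_addPendantsGraph {V : Type u} (G : SimpleGraph V) (a b : V)
    (e : Sym2 (V ⊕ Bool)) : e ∈ (addPendantsGraph G a b).edgeSet ↔
      (∃ d : G.edgeSet, e = oldEdge d.1) ∨ e = lowEdge a ∨ e = highEdge b := by
  have hdiag : ∀ e : Sym2 (V ⊕ Bool), ((∃ d : G.edgeSet, e = oldEdge d.1) ∨ e = lowEdge a ∨
      e = highEdge b) → ¬ e.IsDiag := by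
    rintro e (⟨⟨d, hd⟩, rfl⟩ | rfl | rfl)
    · have := G.not_isDiag_of_mem_edgeSet hd
      induction d using Sym2.ind
      simpa [oldEdge] using this
    · simp [lowEdge]
    · simp [highEdge]
  have hmem : e ∈ (addPendantsGraph G a b).edgeSet ↔
      ((∃ d : G.edgeSet, e = oldEdge d.1) ∨ e = lowEdge a ∨ e = highEdge b) ∧ ¬ e.IsDiag := by
    rw [addPendantsGraph, SimpleGraph.edgeSet_fromEdgeSet]
    refine and_congr ?_ (by simp)
    constructor
    · rintro (⟨d, hd, rfl⟩ | h)
      · exact Or.inl ⟨⟨d, hd⟩, rfl⟩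
      · exact Or.inr h
    · rintro (⟨d, rfl⟩ | h)
      · exact Or.inl ⟨d.1, d.2, rfl⟩
      · exact Or.inr h
  rw [hmem]
  exact ⟨fun h => h.1, fun h => ⟨h, hdiag e h⟩⟩

theorem isStrictTotalOrder_addPendantsLT {V : Type u} (F : EdgeOrderedGraph V) (a b : V) :
    IsStrictTotalOrder _ (addPendantsLT F a b) := by
  have hF1 : ∀ d : F.graph.edgeSet, ¬ F.EdgeLT d d :=
    @lt_irrefl _ F.edgeOrder.toPartialOrder.toPreorder
  have hF2 : ∀ d d' d'' : F.graph.edgeSet, F.EdgeLT d d' → F.EdgeLT d' d'' → F.EdgeLT d d'' :=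
    fun d d' d'' => @lt_trans _ F.edgeOrder.toPartialOrder.toPreorder d d' d''
  have hF3 : ∀ d d' : F.graph.edgeSet, ¬ F.EdgeLT d d' → ¬ F.EdgeLT d' d → d = d' :=
    fun d d' h h' => @le_antisymm _ F.edgeOrder.toPartialOrder d d'
      ((@not_lt _ F.edgeOrder d' d).1 h') ((@not_lt _ F.edgeOrder d d').1 h)
  have hlh := lowEdge_ne_highEdge a b
  have hold : ∀ d d' : F.graph.edgeSet, oldEdge d.1 = oldEdge d'.1 → d = d' :=
    fun d d' h => Subtype.ext (oldEdge_injective h)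
  have hirr : ∀ e, ¬ addPendantsLT F a b e e := by
    rintro e (⟨h, h'⟩ | ⟨h, h'⟩ | ⟨d, d', h, h1, h2⟩)
    · exact h' h
    · exact h h'
    · obtain rfl := hold _ _ (h1.symm.trans h2)
      exact hF1 _ h
  have htrans : ∀ e e' e'', addPendantsLT F a b e e' → addPendantsLT F a b e' e'' →
      addPendantsLT F a b e e'' := by
    rintro e e' e'' (⟨h, h'⟩ | ⟨h, h'⟩ | ⟨d, d', h, h1, h2⟩)
      (⟨k, k'⟩ | ⟨k, k'⟩ | ⟨c, c', k, k1, k2⟩)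
    · exact absurd k h'
    · exact Or.inl ⟨h, fun hh => hlh (hh.symm.trans k')⟩
    · exact Or.inl ⟨h, fun hh => oldEdge_ne_lowEdge _ _ (k2.symm.trans hh)⟩
    · exact absurd (k.symm.trans h') hlh
    · exact absurd h' k
    · exact absurd (k1.symm.trans h') (oldEdge_ne_highEdge _ _)
    · exact absurd (h2.symm.trans k) (oldEdge_ne_lowEdge _ _)
    · exact Or.inr (Or.inl ⟨fun hh => oldEdge_ne_highEdge _ _ (h1.symm.trans hh), k'⟩)
    · obtain rfl := hold _ _ (h2.symm.trans k1)
      exact Or.inr (Or.inr ⟨d, c', hF2 _ _ _ h k, h1, k2⟩)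
  have htri : ∀ e e', ¬ addPendantsLT F a b e e' → ¬ addPendantsLT F a b e' e → e = e' := by
    intro e e' h h'
    apply Subtype.ext
    by_contra hne
    rcases (mem_edgeSet_addPendantsGraph F.graph a b e.1).1 e.2 with ⟨d, hd⟩ | hl | hh
    · rcases (mem_edgeSet_addPendantsGraph F.graph a b e'.1).1 e'.2 with ⟨d', hd'⟩ | hl' | hh'
      · have hdd : d = d' := hF3 d d' (fun hlt => h (Or.inr (Or.inr ⟨d, d', hlt, hd, hd'⟩)))
          (fun hlt => h' (Or.inr (Or.inr ⟨d', d, hlt, hd', hd⟩)))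
        subst hdd
        exact hne (hd.trans hd'.symm)
      · exact h' (Or.inl ⟨hl', fun k => hne (k.trans hl'.symm)⟩)
      · exact h (Or.inr (Or.inl ⟨fun k => hne (k.trans hh'.symm), hh'⟩))
    · exact h (Or.inl ⟨hl, fun k => hne (hl.trans k.symm)⟩)
    · exact h' (Or.inr (Or.inl ⟨fun k => hne (hh.trans k.symm), hh⟩))
  exact { trichotomous := htri, irrefl := hirr, trans := htrans }

open scoped Classical in
/-- The edge-ordered graph obtained from `F` by adding two new vertices and two new edges: one that
joins a new vertex to `a` and is smaller than all other edges, and one that joins the other new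
vertex to `b` and is larger than all other edges. -/
noncomputable def addPendants {V : Type u} (F : EdgeOrderedGraph V) (a b : V) :
    EdgeOrderedGraph (V ⊕ Bool) where
  graph := addPendantsGraph F.graph a b
  edgeOrder :=
    haveI := isStrictTotalOrder_addPendantsLT F a b
    linearOrderOfSTO (addPendantsLT F a b)

end EdgeOrderedGraph

/-!
Every vertex `x` and every sufficiently large set `S` of other vertices contain a copy of `F'`
through `x`. By Ramsey's theorem we may assume that the comparison of two edges in `S ∪ {x}`
depends only on the relative positions of their endpoints, where `x`, written `⊤`, is last. Up to
reversing the order of the edges and that of the vertices in `S`, the edges in `S` are ordered by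
their smaller endpoints first. In such an ordering a copy of `F` always has room for both pendant
edges: by extremality `a` lies on its smallest edge, whose other endpoint can be moved to a
neighbouring position such that the edge becomes smaller, and likewise for `b`. Thus `x` can be
used as a new neighbour of `a` or of `b` whenever an edge to `x` is small or large enough. Otherwise
`S ∪ {x}` too is ordered by smaller endpoints first. If `x` comes first in the row of every vertex
and the other vertices of a row are increasing, an embedding of `F` which maps `a` to the first
vertex leaves room for `x` as a neighbour of `a`. If they are decreasing, `x` can take the place of
the last vertex of a copy of `F'`.

For the tiling, Ramsey's theorem gives a large set `Q` all of whose `|F'|`-subsets span a copy.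
The other vertices are covered one by one, using vertices of `Q` only for the last few of them, and
the remaining part of `Q` can be tiled.
-/

namespace EdgeOrderedGraph

section Ramsey

open Finset

universe w

variable {κ : Type*} {k : ℕ} {n : κ → ℕ}

/-- `N` is an upper bound for the Ramsey number of colourings of `k`-subsets with colour set `κ`:
among any `N` points there are, for some colour `i`, `n i` points whose `k`-subsets all have
colour `i`. -/
def IsRamseyBound (k : ℕ) (n : κ → ℕ) (N : ℕ) : Prop :=
  ∀ ⦃α : Type w⦄ (S : Finset α), N ≤ #S → ∀ χ : Finset α → κ,
    ∃ i, ∃ T ⊆ S, #T = n i ∧ ∀ A ⊆ T, #A = k → χ A = i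

theorem isRamseyBound_zero_left [Fintype κ] (n : κ → ℕ) :
    IsRamseyBound.{w} 0 n (univ.sup n) := by
  intro α S hS χ
  obtain ⟨T, hTS, hT⟩ := exists_subset_card_eq ((le_sup (f := n) (mem_univ (χ ∅))).trans hS)
  exact ⟨χ ∅, T, hTS, hT, fun A _ hA => by rw [card_eq_zero.1 hA]⟩

theorem isRamseyBound_of_eq_zero {i : κ} (hi : n i = 0) : IsRamseyBound.{w} (k + 1) n 0 := by
  refine fun α S _ χ => ⟨i, ∅, empty_subset S, by simp [hi], fun A hA hcard => ?_⟩
  simp [subset_empty.1 hA] at hcard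

theorem IsRamseyBound.succ [DecidableEq κ] {N : κ → ℕ} {R : ℕ} (hn : ∀ i, n i ≠ 0)
    (hN : ∀ i, IsRamseyBound.{w} (k + 1) (Function.update n i (n i - 1)) (N i))
    (hR : IsRamseyBound.{w} k N R) : IsRamseyBound.{w} (k + 1) n (R + 1) := by
  classical
  intro α S hS χ
  obtain ⟨x, hx⟩ : S.Nonempty := card_pos.1 (by omega)
  obtain ⟨i, T, hTS, hTcard, hT⟩ := hR (S.erase x)
    (by rw [card_erase_of_mem hx]; omega) fun A => χ (insert x A)
  have hxT : x ∉ T := fun h => notMem_erase x S (hTS h)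
  replace hTS : T ⊆ S := hTS.trans (erase_subset x S)
  obtain ⟨j, U, hUT, hUcard, hU⟩ := hN i T hTcard.ge χ
  obtain rfl | hji := eq_or_ne j i
  · refine ⟨j, insert x U, insert_subset hx (hUT.trans hTS), ?_, fun A hA hcard => ?_⟩
    · rw [card_insert_of_notMem (fun h => hxT (hUT h)), hUcard, Function.update_self]
      have := hn j
      omega
    · by_cases hxA : x ∈ A
      · rw [← insert_erase hxA]
        exact hT _ ((subset_insert_iff.1 hA).trans hUT) (by rw [card_erase_of_mem hxA, hcard]; rfl)
      · exact hU A ((subset_insert_iff_of_notMem hxA).1 hA) hcard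
  · exact ⟨j, U, hUT.trans hTS, by rwa [Function.update_of_ne hji] at hUcard, hU⟩

theorem exists_isRamseyBound [Finite κ] (k : ℕ) (n : κ → ℕ) : ∃ N, IsRamseyBound.{w} k n N := by
  classical
  have := Fintype.ofFinite κ
  induction k generalizing n with
  | zero => exact ⟨_, isRamseyBound_zero_left n⟩
  | succ k ih =>
    induction hs : ∑ i, n i using Nat.strong_induction_on generalizing n with
    | _ s ihs =>
      by_cases! h0 : ∃ i, n i = 0
      · exact ⟨0, isRamseyBound_of_eq_zero h0.choose_spec⟩
      have hsum (i : κ) : ∑ j, Function.update n i (n i - 1) j < s := by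
        rw [← hs]
        refine sum_lt_sum (fun j _ => ?_) ⟨i, mem_univ i, ?_⟩
        · obtain rfl | hji := eq_or_ne j i <;> simp [*]
        · simpa using Nat.pos_of_ne_zero (h0 i)
      choose N hN using fun i => ihs _ (hsum i) _ rfl
      obtain ⟨R, hR⟩ := ih N
      exact ⟨R + 1, .succ h0 hN hR⟩

theorem exists_orderEmb_monochromatic (κ : Type*) [Finite κ] (r n : ℕ) :
    ∃ N, ∀ χ : (Fin r ↪o Fin N) → κ, ∃ e : Fin n ↪o Fin N,
      ∀ f g : Fin r ↪o Fin n, χ (f.trans e) = χ (g.trans e) := by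
  obtain ⟨N, hN⟩ := exists_isRamseyBound (κ := Option κ) r fun _ => n
  refine ⟨N, fun χ => ?_⟩
  obtain ⟨i, T, -, hTcard, hT⟩ := hN (univ : Finset (Fin N)) (by simp)
    fun A => if h : #A = r then some (χ (A.orderEmbOfFin h)) else none
  let e : Fin n ↪o Fin N := T.orderEmbOfFin hTcard
  have hcolour (f : Fin r ↪o Fin n) : some (χ (f.trans e)) = i := by
    have hcard : #(univ.map (f.trans e).toEmbedding) = r := by simp
    have hsub : univ.map (f.trans e).toEmbedding ⊆ T := by
      intro y hy
      obtain ⟨j, -, rfl⟩ := mem_map.1 hy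
      exact T.orderEmbOfFin_mem hTcard (f j)
    have hrange := orderEmbOfFin_unique' hcard (f := f.trans e) fun j =>
      mem_map_of_mem _ (mem_univ j)
    rw [← hT _ hsub hcard, dif_pos hcard, ← hrange]
  exact ⟨e, fun f g => Option.some_injective _ ((hcolour f).trans (hcolour g).symm)⟩

end Ramsey

section Tiling

open Finset

universe w

variable {α : Type w} [DecidableEq α] {𝓕 : Set (Finset α)} {k M : ℕ} {A Q S U X : Finset α}

/-- `X` can be partitioned into members of `𝓕`. -/
def IsTiled (𝓕 : Set (Finset α)) (X : Finset α) : Prop :=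
  ∃ P : Finpartition X, ∀ A ∈ P.parts, A ∈ 𝓕

/-- Every point `x` lies in a member of `𝓕` whose other points are taken from a prescribed set,
as soon as that set has at least `M` elements. -/
def IsCovering (𝓕 : Set (Finset α)) (M : ℕ) : Prop :=
  ∀ (x : α) (S : Finset α), x ∉ S → M ≤ #S → ∃ A ∈ 𝓕, x ∈ A ∧ A ⊆ insert x S

theorem isTiled_empty : IsTiled 𝓕 ∅ :=
  ⟨Finpartition.empty _, by simp⟩

theorem IsTiled.of_sdiff (hA : A ∈ 𝓕) (hne : A.Nonempty) (hAX : A ⊆ X)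
    (h : IsTiled 𝓕 (X \ A)) : IsTiled 𝓕 X := by
  obtain ⟨P, hP⟩ := h
  refine ⟨P.extend hne.ne_empty sdiff_disjoint (sdiff_union_of_subset hAX), fun B hB => ?_⟩
  obtain rfl | hB := mem_insert.1 hB
  exacts [hA, hP B hB]

theorem isTiled_of_powersetCard_subset (hk : 0 < k) (hQ : ↑(powersetCard k Q) ⊆ 𝓕)
    (hdvd : k ∣ #Q) : IsTiled 𝓕 Q := by
  obtain ⟨m, hm⟩ := hdvd
  induction m generalizing Q with
  | zero => rw [card_eq_zero.1 hm]; exact isTiled_empty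
  | succ m ih =>
    obtain ⟨A, hAQ, hA⟩ := exists_subset_card_eq (hm ▸ Nat.le_mul_of_pos_right k m.succ_pos)
    refine .of_sdiff (hQ (mem_coe.2 (mem_powersetCard.2 ⟨hAQ, hA⟩))) (card_pos.1 (hA ▸ hk)) hAQ
      (ih (Set.Subset.trans (coe_subset.2 (powersetCard_mono sdiff_subset)) hQ) ?_)
    rw [card_sdiff_of_subset hAQ, hA, hm, mul_add_one, Nat.add_sub_cancel]

theorem insert_union_sdiff {x : α} (hxU : x ∉ U) (hUS : Disjoint U S) (hxA : x ∈ A)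
    (hAS : A ⊆ insert x S) : (insert x U ∪ S) \ A = U ∪ S \ A := by
  have hUA : Disjoint U A :=
    (disjoint_insert_right.2 ⟨hxU, hUS⟩).mono_right hAS
  rw [union_sdiff_distrib, insert_sdiff_of_mem _ hxA, sdiff_eq_self_of_disjoint hUA]

theorem IsCovering.isTiled_union_of_card_le (h𝓕 : IsCovering 𝓕 M) (hsized : 𝓕.Sized k) (hk : 0 < k)
    (hS : ↑(powersetCard k S) ⊆ 𝓕) (hUS : Disjoint U S) (hdvd : k ∣ #(U ∪ S))
    (hcard : M + k * #U ≤ #S) : IsTiled 𝓕 (U ∪ S) := by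
  induction U using Finset.induction_on generalizing S with
  | empty =>
    rw [empty_union] at hdvd ⊢
    exact isTiled_of_powersetCard_subset hk hS hdvd
  | insert x U hxU ih =>
    rw [disjoint_insert_left] at hUS
    rw [card_insert_of_notMem hxU, mul_add_one] at hcard
    obtain ⟨A, hA, hxA, hAS⟩ := h𝓕 x S hUS.1 (by omega)
    have hAX : A ⊆ insert x U ∪ S := hAS.trans (insert_subset (by simp) subset_union_right)
    have hsdiff := insert_union_sdiff hxU hUS.2 hxA hAS
    have hcardX := card_sdiff_of_subset hAX
    have hcardS := le_card_sdiff A S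
    rw [hsized hA] at hcardX hcardS
    refine .of_sdiff hA ⟨x, hxA⟩ hAX ?_
    rw [hsdiff] at hcardX ⊢
    exact ih (Set.Subset.trans (coe_subset.2 (powersetCard_mono sdiff_subset)) hS)
      (hUS.2.mono_right sdiff_subset) (hcardX ▸ Nat.dvd_sub hdvd dvd_rfl) (by omega)

theorem IsCovering.isTiled_union (h𝓕 : IsCovering 𝓕 M) (hsized : 𝓕.Sized k) (hk : 0 < k)
    (hQ : ↑(powersetCard k Q) ⊆ 𝓕) (hcard : M + k * M ≤ #Q) (hUQ : Disjoint U Q)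
    (hdvd : k ∣ #(U ∪ Q)) : IsTiled 𝓕 (U ∪ Q) := by
  induction U using Finset.strongInduction with
  | H U ih =>
    obtain hUM | hUM := le_or_gt #U M
    · exact h𝓕.isTiled_union_of_card_le hsized hk hQ hUQ hdvd
        (le_trans (by gcongr) hcard)
    · obtain ⟨x, hx⟩ : U.Nonempty := card_pos.1 (by omega)
      obtain ⟨A, hA, hxA, hAU⟩ := h𝓕 x (U.erase x) (notMem_erase x U)
        (by rw [card_erase_of_mem hx]; omega)
      rw [insert_erase hx] at hAU
      have hAX : A ⊆ U ∪ Q := hAU.trans subset_union_left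
      have hsdiff : (U ∪ Q) \ A = U \ A ∪ Q := by
        rw [union_sdiff_distrib, sdiff_eq_self_of_disjoint (hUQ.mono_left hAU).symm]
      have hcardX := card_sdiff_of_subset hAX
      rw [hsized hA] at hcardX
      refine .of_sdiff hA ⟨x, hxA⟩ hAX ?_
      rw [hsdiff] at hcardX ⊢
      exact ih _ (sdiff_ssubset hAU ⟨x, hxA⟩) (hUQ.mono_left sdiff_subset)
        (hcardX ▸ Nat.dvd_sub hdvd dvd_rfl)

theorem IsCovering.exists_powersetCard_subset (h𝓕 : IsCovering 𝓕 M) (hsized : 𝓕.Sized k) {m N : ℕ}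
    (hm : M < m) (hN : IsRamseyBound.{w} k (fun _ : Prop => m) N) (hS : N ≤ #S) :
    ∃ Q ⊆ S, #Q = m ∧ ↑(powersetCard k Q) ⊆ 𝓕 := by
  obtain ⟨p, Q, hQS, hQcard : #Q = m, hQ⟩ := hN S hS (· ∈ 𝓕)
  obtain ⟨x, hx⟩ : Q.Nonempty := card_pos.1 (by omega)
  obtain ⟨A, hA, -, hAQ⟩ := h𝓕 x (Q.erase x) (notMem_erase x Q)
    (by rw [card_erase_of_mem hx]; omega)
  rw [insert_erase hx] at hAQ
  refine ⟨Q, hQS, hQcard, fun B hB => ?_⟩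
  obtain ⟨hBQ, hBcard⟩ := mem_powersetCard.1 (mem_coe.1 hB)
  exact ((hQ B hBQ hBcard).trans (hQ A hAQ (hsized hA)).symm).mpr hA

theorem exists_forall_isTiled_univ (hk : 0 < k) (M : ℕ) :
    ∃ N, ∀ ⦃α : Type w⦄ [DecidableEq α] [Fintype α] (𝓕 : Set (Finset α)), 𝓕.Sized k →
      IsCovering 𝓕 M → N ≤ Fintype.card α → k ∣ Fintype.card α → IsTiled 𝓕 univ := by
  obtain ⟨N, hN⟩ := exists_isRamseyBound.{w} k fun _ : Prop => M + k * M + 1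
  refine ⟨N, fun α _ _ 𝓕 hsized h𝓕 hcard hdvd => ?_⟩
  obtain ⟨Q, -, hQcard, hQ⟩ := h𝓕.exists_powersetCard_subset hsized (by omega) hN
    (S := univ) (by rwa [card_univ])
  have hunion : univ \ Q ∪ Q = univ := sdiff_union_of_subset (subset_univ Q)
  rw [← card_univ, ← hunion] at hdvd
  rw [← hunion]
  exact h𝓕.isTiled_union hsized hk hQ (by omega) sdiff_disjoint hdvd

end Tiling

section Copies

open Finset

variable {V W : Type*} {F : EdgeOrderedGraph V} {H : EdgeOrderedGraph W}

theorem Embedding.ncard_vertexSet (φ : Embedding F H) : φ.vertexSet.ncard = Nat.card V :=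
  Set.ncard_range_of_injective φ.toCopy.injective

theorem hasPerfectTiling_of_isTiled [Fintype W] [DecidableEq W]
    (h : IsTiled {A : Finset W | ∃ φ : Embedding F H, φ.vertexSet = A} univ) :
    H.HasPerfectTiling F := by
  obtain ⟨P, hP⟩ := h
  choose φ hφ using hP
  refine ⟨Set.range fun A : P.parts => φ A.1 A.2, ?_, fun w => ?_⟩
  · rintro _ ⟨⟨A, hA⟩, rfl⟩ _ ⟨⟨B, hB⟩, rfl⟩ hne
    rw [Function.onFun, hφ A hA, hφ B hB, disjoint_coe]
    exact P.disjoint hA hB fun hAB => hne (by subst hAB; rfl)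
  · obtain ⟨A, hA, hwA⟩ := P.exists_mem (mem_univ w)
    exact ⟨φ A hA, ⟨⟨A, hA⟩, rfl⟩, by rwa [hφ A hA]⟩

theorem tileable_of_forall_exists_embedding [Fintype V] [Nonempty V] (M : ℕ)
    (hF : ∀ (t : ℕ) (o : LinearOrder (⊤ : SimpleGraph (Fin t)).edgeSet) (x : Fin t)
      (S : Finset (Fin t)), x ∉ S → M ≤ #S →
        ∃ φ : Embedding F (complete t o), x ∈ φ.vertexSet ∧ φ.vertexSet ⊆ insert x ↑S) :
    F.Tileable := by
  obtain ⟨N, hN⟩ := exists_forall_isTiled_univ (Fintype.card_pos (α := V)) M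
  refine ⟨Fintype.card V * (N + 1), Nat.mul_pos Fintype.card_pos N.succ_pos, dvd_mul_right _ _,
    fun o => hasPerfectTiling_of_isTiled (hN _ ?_ ?_ ?_ ?_)⟩
  · rintro A ⟨φ, hφ⟩
    rw [← Set.ncard_coe_finset, ← hφ, φ.ncard_vertexSet, Nat.card_eq_fintype_card]
  · intro x S hxS hS
    obtain ⟨φ, hxφ, hφS⟩ := hF _ o x S hxS hS
    refine ⟨φ.vertexSet.toFinite.toFinset, ⟨φ, by simp⟩, by simpa, ?_⟩
    rwa [← coe_subset, Set.Finite.coe_toFinset, coe_insert]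
  · rw [Fintype.card_fin]
    nlinarith [Fintype.card_pos (α := V)]
  · simp

end Copies

open Function

section Labellings

variable {V : Type*} {W : Type*} {W' : Type*} {F : EdgeOrderedGraph V} {H : EdgeOrderedGraph W}
  {G : SimpleGraph V} {l : Sym2 V → ℤ} {c : Sym2 W → ℤ} {a b : V}

/-- `l` is an increasing labelling of the edges of `F` by integers. It is extended injectively to
all pairs of vertices. -/
structure IsLabelling (F : EdgeOrderedGraph V) (l : Sym2 V → ℤ) : Prop where
  injective : Injective l
  edgeLT_iff : ∀ e e' : F.graph.edgeSet, F.EdgeLT e e' ↔ l e < l e'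

theorem exists_strictMono_nat (α : Type*) [LinearOrder α] [Finite α] :
    ∃ f : α → ℕ, StrictMono f := by
  have := Fintype.ofFinite α
  exact ⟨_, Fin.val_strictMono.comp (Fintype.orderIsoFinOfCardEq α rfl).symm.strictMono⟩

theorem exists_isLabelling [Finite V] (F : EdgeOrderedGraph V) : ∃ l, F.IsLabelling l := by
  classical
  let _ := F.edgeOrder
  obtain ⟨f, hf⟩ := exists_strictMono_nat F.graph.edgeSet
  obtain ⟨g, hg⟩ := exists_injective_nat (Sym2 V)
  refine ⟨fun e => if h : e ∈ F.graph.edgeSet then (f ⟨e, h⟩ : ℤ) else -1 - (g e : ℤ), ?_, ?_⟩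
  · intro e e' h
    by_cases he : e ∈ F.graph.edgeSet <;> by_cases he' : e' ∈ F.graph.edgeSet <;>
      simp only [he, he', dite_true, dite_false] at h
    · exact congrArg Subtype.val (hf.injective (Int.ofNat_inj.1 h))
    · omega
    · omega
    · exact hg (by omega)
  · intro e e'
    have hlt : F.EdgeLT e e' ↔ f e < f e' := hf.lt_iff_lt.symm
    simpa using hlt

/-- `φ` is a copy of `G`, with edges ordered by `l`, in the complete graph on `W` with edges ordered
by `c`. -/
structure IsCopy (G : SimpleGraph V) (l : Sym2 V → ℤ) (c : Sym2 W → ℤ) (φ : V → W) : Prop where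
  injective : Injective φ
  map_lt_map : ∀ e ∈ G.edgeSet, ∀ e' ∈ G.edgeSet, l e < l e' → c (e.map φ) < c (e'.map φ)

theorem IsCopy.neg {φ : V → W} (h : IsCopy G l c φ) : IsCopy G (-l) (-c) φ where
  injective := h.injective
  map_lt_map e he e' he' hlt := neg_lt_neg (h.map_lt_map e' he' e he (neg_lt_neg_iff.1 hlt))

theorem IsCopy.comp {q : W' → W} (hq : Injective q) {φ : V → W'}
    (h : IsCopy G l (c ∘ Sym2.map q) φ) : IsCopy G l c (q ∘ φ) where
  injective := hq.comp h.injective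
  map_lt_map e he e' he' hlt := by
    simpa only [comp_apply, Sym2.map_map] using h.map_lt_map e he e' he' hlt

theorem IsCopy.map_le_map {φ : V → W} (h : IsCopy G l c φ) (hl : Injective l) {e e' : Sym2 V}
    (he : e ∈ G.edgeSet) (he' : e' ∈ G.edgeSet) (hle : l e ≤ l e') :
    c (e.map φ) ≤ c (e'.map φ) := by
  obtain hlt | heq := hle.lt_or_eq
  · exact (h.map_lt_map e he e' he' hlt).le
  · rw [hl heq]

theorem Embedding.isCopy (hl : F.IsLabelling l)
    (hc : ∀ e e' : H.graph.edgeSet, H.EdgeLT e e' → c e < c e') (φ : Embedding F H) :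
    IsCopy F.graph l c φ.toCopy where
  injective := φ.toCopy.injective
  map_lt_map e he e' he' hlt :=
    hc _ _ (φ.edgeLT_map ⟨e, he⟩ ⟨e', he'⟩ ((hl.edgeLT_iff ⟨e, he⟩ ⟨e', he'⟩).2 hlt))

theorem Turanable.exists_isCopy (hF : F.Turanable) (hl : F.IsLabelling l) :
    ∃ t, ∀ c : Sym2 (Fin t) → ℤ, Injective c → ∃ φ, IsCopy F.graph l c φ := by
  obtain ⟨t, -, ht⟩ := hF
  refine ⟨t, fun c hc => ?_⟩
  obtain ⟨φ⟩ := ht (LinearOrder.lift' (fun e => c e) (hc.comp Subtype.val_injective))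
  exact ⟨_, φ.isCopy hl fun _ _ h => h⟩

/-- `ψ` is a copy of `G`, with edges ordered by `l`, together with a smallest pendant edge at `a`
and a largest pendant edge at `b`, in the complete graph on `W` with edges ordered by `c`. -/
structure IsPendantCopy (G : SimpleGraph V) (l : Sym2 V → ℤ) (a b : V) (c : Sym2 W → ℤ)
    (ψ : V ⊕ Bool → W) : Prop where
  injective : Injective ψ
  map_lt_map : ∀ e ∈ G.edgeSet, ∀ e' ∈ G.edgeSet, l e < l e' →
    c ((oldEdge e).map ψ) < c ((oldEdge e').map ψ)
  lowEdge_lt : ∀ e ∈ G.edgeSet, c ((lowEdge a).map ψ) < c ((oldEdge e).map ψ)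
  lt_highEdge : ∀ e ∈ G.edgeSet, c ((oldEdge e).map ψ) < c ((highEdge b).map ψ)

theorem IsCopy.isPendantCopy {φ : V → W} (h : IsCopy G l c φ) {p r : W} (hp : p ∉ Set.range φ)
    (hr : r ∉ Set.range φ) (hpr : p ≠ r) (hlow : ∀ e ∈ G.edgeSet, c s(p, φ a) < c (e.map φ))
    (hhigh : ∀ e ∈ G.edgeSet, c (e.map φ) < c s(r, φ b)) :
    IsPendantCopy G l a b c (Sum.elim φ fun i => cond i r p) := by
  have hold (e : Sym2 V) : (oldEdge e).map (Sum.elim φ fun i => cond i r p) = e.map φ := by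
    rw [oldEdge, Sym2.map_map, Sum.elim_comp_inl]
  refine ⟨h.injective.sumElim ?_ ?_, ?_, ?_, ?_⟩
  · rw [Bool.injective_iff]
    exact hpr
  · rintro v (_ | _) rfl
    exacts [hp (Set.mem_range_self v), hr (Set.mem_range_self v)]
  · simpa only [hold] using h.map_lt_map
  · intro e he
    rw [hold]
    exact hlow e he
  · intro e he
    rw [hold]
    exact hhigh e he

theorem IsPendantCopy.neg {ψ : V ⊕ Bool → W} (h : IsPendantCopy G l a b c ψ) :
    IsPendantCopy G (-l) b a (-c) (ψ ∘ Sum.map id not) := by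
  have hold (e : Sym2 V) : (oldEdge e).map (ψ ∘ Sum.map id not) = (oldEdge e).map ψ := by
    simp only [oldEdge, Sym2.map_map]
    rfl
  refine ⟨h.injective.comp (injective_id.sumMap Bool.involutive_not.injective), ?_, ?_, ?_⟩ <;>
    simp only [hold]
  · exact fun e he e' he' hlt => neg_lt_neg (h.map_lt_map e' he' e he (neg_lt_neg_iff.1 hlt))
  · exact fun e he => neg_lt_neg (h.lt_highEdge e he)
  · exact fun e he => neg_lt_neg (h.lowEdge_lt e he)

theorem IsPendantCopy.comp {q : W' → W} (hq : Injective q) {ψ : V ⊕ Bool → W'}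
    (h : IsPendantCopy G l a b (c ∘ Sym2.map q) ψ) : IsPendantCopy G l a b c (q ∘ ψ) where
  injective := hq.comp h.injective
  map_lt_map := by simpa only [comp_apply, Sym2.map_map] using h.map_lt_map
  lowEdge_lt := by simpa only [comp_apply, Sym2.map_map] using h.lowEdge_lt
  lt_highEdge := by simpa only [comp_apply, Sym2.map_map] using h.lt_highEdge

theorem IsPendantCopy.of_comp {q : W' → W} {ψ : V ⊕ Bool → W'}
    (h : IsPendantCopy G l a b c (q ∘ ψ)) : IsPendantCopy G l a b (c ∘ Sym2.map q) ψ where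
  injective := h.injective.of_comp
  map_lt_map := by simpa only [comp_apply, Sym2.map_map] using h.map_lt_map
  lowEdge_lt := by simpa only [comp_apply, Sym2.map_map] using h.lowEdge_lt
  lt_highEdge := by simpa only [comp_apply, Sym2.map_map] using h.lt_highEdge

theorem IsPendantCopy.edgeLT {ψ : V ⊕ Bool → W} (hl : F.IsLabelling l) (ha : ¬F.graph.IsIsolated a)
    (h : IsPendantCopy F.graph l a b c ψ) {e e' : (F.addPendants a b).graph.edgeSet}
    (hlt : (F.addPendants a b).EdgeLT e e') :
    c (e.1.map ψ) < c (e'.1.map ψ) := by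
  have hlowhigh : c ((lowEdge a).map ψ) < c ((highEdge b).map ψ) := by
    simp only [SimpleGraph.IsIsolated, not_forall, not_not] at ha
    obtain ⟨w, hw⟩ := ha
    exact (h.lowEdge_lt s(a, w) hw).trans (h.lt_highEdge s(a, w) hw)
  have hmem := fun e => (mem_edgeSet_addPendantsGraph F.graph a b e).1
  replace hlt : addPendantsLT F a b e e' := hlt
  obtain ⟨he, he'⟩ | ⟨he, he'⟩ | ⟨d, d', hd, he, he'⟩ := hlt
  · obtain ⟨d, hd⟩ | hd | hd := hmem e' e'.2
    · rw [he, hd]; exact h.lowEdge_lt d d.2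
    · exact absurd hd he'
    · rwa [he, hd]
  · obtain ⟨d, hd⟩ | hd | hd := hmem e e.2
    · rw [he', hd]; exact h.lt_highEdge d d.2
    · rwa [he', hd]
    · exact absurd hd he
  · rw [he, he']
    exact h.map_lt_map d d.2 d' d'.2 ((hl.edgeLT_iff d d').1 hd)

theorem IsPendantCopy.exists_embedding {o : LinearOrder (⊤ : SimpleGraph W).edgeSet}
    {ψ : V ⊕ Bool → W} (hl : F.IsLabelling l) (hc : IsLabelling ⟨⊤, o⟩ c)
    (ha : ¬F.graph.IsIsolated a) (h : IsPendantCopy F.graph l a b c ψ) :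
    ∃ ψ' : Embedding (F.addPendants a b) ⟨⊤, o⟩, ψ'.vertexSet = Set.range ψ :=
  ⟨⟨⟨⟨ψ, fun hvw => h.injective.ne hvw.ne⟩, h.injective⟩, fun _ _ hlt =>
    (hc.edgeLT_iff _ _).2 (h.edgeLT hl ha hlt)⟩, rfl⟩

/-- Some copy of `G` with its two pendant edges covers the vertex `x`. -/
def HasPendantCopyThrough (G : SimpleGraph V) (l : Sym2 V → ℤ) (a b : V) (c : Sym2 W → ℤ)
    (x : W) : Prop :=
  ∃ ψ, IsPendantCopy G l a b c ψ ∧ x ∈ Set.range ψ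

theorem HasPendantCopyThrough.neg {x : W} (h : HasPendantCopyThrough G l a b c x) :
    HasPendantCopyThrough G (-l) b a (-c) x := by
  obtain ⟨ψ, hψ, hx⟩ := h
  refine ⟨_, hψ.neg, ?_⟩
  rwa [(surjective_id.sumMap Bool.involutive_not.surjective).range_comp]

theorem HasPendantCopyThrough.comp {q : W' → W} (hq : Injective q) {x : W'}
    (h : HasPendantCopyThrough G l a b (c ∘ Sym2.map q) x) :
    HasPendantCopyThrough G l a b c (q x) := by
  obtain ⟨ψ, hψ, v, rfl⟩ := h
  exact ⟨_, hψ.comp hq, v, rfl⟩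

end Labellings

section Orderings

variable {V : Type*} {W : Type*} {I : Type*} {J : Type*} [LinearOrder I] [LinearOrder J]
  {F : EdgeOrderedGraph V} {G : SimpleGraph V} {l : Sym2 V → ℤ} {a b : V}

/-- The labellings `c` and `c'` order the edges of the complete graph in the same way. -/
def SameEdgeOrder (c c' : Sym2 W → ℤ) : Prop :=
  ∀ ⦃e e' : Sym2 W⦄, ¬e.IsDiag → ¬e'.IsDiag → (c e < c e' ↔ c' e < c' e')

/-- Edges with distinct smaller endpoints are ordered by these, as in the min ordering. -/
def OrderedByMin (c : Sym2 I → ℤ) : Prop :=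
  ∀ ⦃i j k m : I⦄, i < j → k < m → i < k → c s(i, j) < c s(k, m)

/-- Edges with the same smaller endpoint are ordered by their larger endpoints, as in the min
ordering. -/
def RowsIncreasing (c : Sym2 I → ℤ) : Prop :=
  ∀ ⦃i j k : I⦄, i < j → j < k → c s(i, j) < c s(i, k)

theorem not_isDiag_map {φ : V → W} (hφ : Injective φ) {e : Sym2 V} (he : ¬e.IsDiag) :
    ¬(e.map φ).IsDiag := by
  rwa [Sym2.isDiag_map hφ]

theorem SameEdgeOrder.isCopy {c c' : Sym2 W → ℤ} (h : SameEdgeOrder c c') {φ : V → W}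
    (hφ : IsCopy G l c φ) : IsCopy G l c' φ where
  injective := hφ.injective
  map_lt_map e he e' he' hlt :=
    (h (not_isDiag_map hφ.injective (G.not_isDiag_of_mem_edgeSet he))
      (not_isDiag_map hφ.injective (G.not_isDiag_of_mem_edgeSet he'))).1
      (hφ.map_lt_map e he e' he' hlt)

theorem SameEdgeOrder.isPendantCopy {c c' : Sym2 W → ℤ} (h : SameEdgeOrder c c') {ψ : V ⊕ Bool → W}
    (hψ : IsPendantCopy G l a b c ψ) : IsPendantCopy G l a b c' ψ := by
  have hold {e : Sym2 V} (he : e ∈ G.edgeSet) : ¬((oldEdge e).map ψ).IsDiag :=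
    not_isDiag_map hψ.injective
      (not_isDiag_map Sum.inl_injective (G.not_isDiag_of_mem_edgeSet he))
  have hlow : ¬((lowEdge a).map ψ).IsDiag := not_isDiag_map hψ.injective (by simp [lowEdge])
  have hhigh : ¬((highEdge b).map ψ).IsDiag := not_isDiag_map hψ.injective (by simp [highEdge])
  exact ⟨hψ.injective,
    fun e he e' he' hlt => (h (hold he) (hold he')).1 (hψ.map_lt_map e he e' he' hlt),
    fun e he => (h hlow (hold he)).1 (hψ.lowEdge_lt e he),
    fun e he => (h (hold he) hhigh).1 (hψ.lt_highEdge e he)⟩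

theorem exists_lt_eq_mk {e : Sym2 I} (he : ¬e.IsDiag) : ∃ i j, i < j ∧ e = s(i, j) := by
  induction e using Sym2.ind with
  | _ i j =>
    obtain h | h := lt_or_gt_of_ne (Sym2.mk_isDiag_iff.not.1 he)
    exacts [⟨i, j, h, rfl⟩, ⟨j, i, h, Sym2.eq_swap⟩]

theorem RowsIncreasing.lt_iff_lt {c : Sym2 I → ℤ} (hc : RowsIncreasing c) {i j k : I} (hij : i < j)
    (hik : i < k) : c s(i, j) < c s(i, k) ↔ j < k := by
  refine ⟨fun h => not_le.1 fun hkj => h.not_ge ?_, hc hij⟩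
  obtain hkj | rfl := hkj.lt_or_eq
  exacts [(hc hik hkj).le, le_rfl]

theorem OrderedByMin.sameEdgeOrder {c c' : Sym2 I → ℤ} (hc : OrderedByMin c) (hc' : OrderedByMin c')
    (hrow : ∀ ⦃i j k⦄, i < j → i < k → (c s(i, j) < c s(i, k) ↔ c' s(i, j) < c' s(i, k))) :
    SameEdgeOrder c c' := by
  intro e e' he he'
  obtain ⟨i, j, hij, rfl⟩ := exists_lt_eq_mk he
  obtain ⟨k, m, hkm, rfl⟩ := exists_lt_eq_mk he'
  obtain h | rfl | h := lt_trichotomy i k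
  · exact iff_of_true (hc hij hkm h) (hc' hij hkm h)
  · exact hrow hij hkm
  · exact iff_of_false (hc hkm hij h).not_gt (hc' hkm hij h).not_gt

theorem OrderedByMin.comp {c : Sym2 I → ℤ} (hc : OrderedByMin c) {q : J → I} (hq : StrictMono q) :
    OrderedByMin (c ∘ Sym2.map q) :=
  fun _ _ _ _ hij hkm hik => hc (hq hij) (hq hkm) (hq hik)

theorem RowsIncreasing.comp {c : Sym2 I → ℤ} (hc : RowsIncreasing c) {q : J → I}
    (hq : StrictMono q) : RowsIncreasing (c ∘ Sym2.map q) :=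
  fun _ _ _ hij hjk => hc (hq hij) (hq hjk)

/-- Up to reversal, edges with distinct smaller endpoints are ordered by these. Up to reversal,
edges with the same smaller endpoint are ordered by their larger endpoints. -/
def IsLexicographic (d : Sym2 I → ℤ) : Prop :=
  (OrderedByMin d ∨ OrderedByMin (-d)) ∧ (RowsIncreasing d ∨ RowsIncreasing (-d))

theorem IsLexicographic.neg {d : Sym2 I → ℤ} (hd : IsLexicographic d) : IsLexicographic (-d) := by
  rw [IsLexicographic, neg_neg]
  exact ⟨hd.1.symm, hd.2.symm⟩

theorem IsLexicographic.exists_neighbour_lt {d : Sym2 I → ℤ} (hd : IsLexicographic d)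
    {i j k m : I} (hij : i < j) (hjk : j < k)
    (hm : m < i ∨ k < m) : d s(i, m) < d s(j, m) ∨ d s(k, m) < d s(j, m) := by
  obtain hm | hm := hm
  · rw [Sym2.eq_swap (a := i), Sym2.eq_swap (a := j), Sym2.eq_swap (a := k)]
    exact hd.2.imp (fun h => h hm hij) fun h => neg_lt_neg_iff.1 (h (hm.trans hij) hjk)
  · have hjm := hjk.trans hm
    exact hd.1.imp (fun h => h (hij.trans hjm) hjm hij) fun h => neg_lt_neg_iff.1 (h hjm hm hjk)

theorem minLabel_mk {n : ℕ} {i j : Fin n} (hij : i < j) :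
    minLabel n s(i, j) = 2 * n * (i + 1) + (j + 1) - 1 := by
  simp only [minLabel, Sym2.inf_mk, Sym2.sup_mk, inf_of_le_left hij.le, sup_of_le_right hij.le]

theorem maxLabel_mk_rev {n : ℕ} {i j : Fin n} (hij : i < j) :
    maxLabel n s(i.rev, j.rev) = (2 * n - 1) * (n - i) + (n - j) := by
  have hji := Fin.rev_lt_rev.2 hij
  simp only [maxLabel, Sym2.inf_mk, Sym2.sup_mk, inf_of_le_right hji.le, sup_of_le_left hji.le]
  simp only [Fin.val_rev]
  rw [Nat.cast_sub (by omega), Nat.cast_sub (by omega)]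
  push_cast
  ring

theorem orderedByMin_minLabel (n : ℕ) : OrderedByMin (minLabel n) := by
  intro i j k m hij hkm hik
  rw [minLabel_mk hij, minLabel_mk hkm]
  nlinarith [Fin.lt_def.1 hik, j.isLt]

theorem rowsIncreasing_minLabel (n : ℕ) : RowsIncreasing (minLabel n) := by
  intro i j k hij hjk
  rw [minLabel_mk hij, minLabel_mk (hij.trans hjk)]
  have := Fin.lt_def.1 hjk
  omega

theorem orderedByMin_neg_maxLabel_rev (n : ℕ) :
    OrderedByMin (-(maxLabel n ∘ Sym2.map Fin.rev)) := by
  intro i j k m hij hkm hik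
  simp only [Pi.neg_apply, comp_apply, Sym2.map_mk, neg_lt_neg_iff]
  rw [maxLabel_mk_rev hij, maxLabel_mk_rev hkm]
  nlinarith [Fin.lt_def.1 hik, j.isLt, m.isLt]

theorem rowsIncreasing_neg_maxLabel_rev (n : ℕ) :
    RowsIncreasing (-(maxLabel n ∘ Sym2.map Fin.rev)) := by
  intro i j k hij hjk
  simp only [Pi.neg_apply, comp_apply, Sym2.map_mk, neg_lt_neg_iff]
  rw [maxLabel_mk_rev hij, maxLabel_mk_rev (hij.trans hjk)]
  have := Fin.lt_def.1 hjk
  omega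

/-- Some copy of `G` in the min ordering of `K_t` has `a` as its first vertex. -/
def IsMinimalIn (G : SimpleGraph V) (l : Sym2 V → ℤ) (a : V) (t : ℕ) : Prop :=
  ∃ φ : V → Fin t, IsCopy G l (minLabel t) φ ∧ ∀ v, φ a ≤ φ v

theorem IsCopy.isMinimalIn {n t : ℕ} (hnt : n ≤ t) {c : Sym2 (Fin n) → ℤ} {φ : V → Fin n}
    (h : IsCopy G l c φ) (hc : OrderedByMin c) (hrow : RowsIncreasing c) (ha : ∀ v, φ a ≤ φ v) :
    IsMinimalIn G l a t := by
  have hq := (Fin.castLEOrderEmb hnt).strictMono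
  have hsame : SameEdgeOrder c (minLabel t ∘ Sym2.map (Fin.castLEOrderEmb hnt)) :=
    hc.sameEdgeOrder ((orderedByMin_minLabel t).comp hq) fun i j k hij hik =>
      (hrow.lt_iff_lt hij hik).trans
        (((rowsIncreasing_minLabel t).comp hq).lt_iff_lt hij hik).symm
  exact ⟨_, (hsame.isCopy h).comp hq.injective, fun v => hq.monotone (ha v)⟩

theorem IsMinimalIn.exists_least_edge {t : ℕ} [Finite V] (h : IsMinimalIn G l a t)
    (ha : ¬G.IsIsolated a) : ∃ w, G.Adj a w ∧ ∀ e ∈ G.edgeSet, l s(a, w) ≤ l e := by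
  obtain ⟨φ, hφ, hmin⟩ := h
  have hlt {v : V} (hv : v ≠ a) : φ a < φ v := (hmin v).lt_of_ne (hφ.injective.ne hv.symm)
  simp only [SimpleGraph.IsIsolated, not_forall, not_not] at ha
  obtain ⟨w, hw, hwmin⟩ := Set.exists_min_image {w | G.Adj a w} (fun w => l s(a, w))
    (Set.toFinite _) ha
  refine ⟨w, hw, fun e he => ?_⟩
  by_cases hae : a ∈ e
  · obtain ⟨v, rfl⟩ := hae
    exact hwmin v he
  · refine not_lt.1 fun hle => (hφ.map_lt_map e he s(a, w) hw hle).not_gt ?_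
    obtain ⟨i, j, hij, hmap⟩ :=
      exists_lt_eq_mk (not_isDiag_map hφ.injective (G.not_isDiag_of_mem_edgeSet he))
    obtain ⟨v, hv, rfl⟩ := Sym2.mem_map.1 (hmap ▸ Sym2.mem_mk_left i j)
    rw [hmap]
    exact orderedByMin_minLabel t (hlt hw.ne') hij (hlt fun h => hae (h ▸ hv))

variable [Fintype V]

theorem IsMinimalVertex.isMinimalIn (hl : F.IsLabelling l) (ha : F.IsMinimalVertex a) {t : ℕ}
    (ht : Fintype.card V ≤ t) : IsMinimalIn F.graph l a t := by
  obtain ⟨φ, hφ⟩ := ha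
  have hcopy : IsCopy F.graph l (minLabel _) φ.toCopy := φ.isCopy hl fun _ _ h => h
  exact hcopy.isMinimalIn ht (orderedByMin_minLabel _) (rowsIncreasing_minLabel _)
    fun v => Fin.le_def.2 (hφ.trans_le (Nat.zero_le _))

theorem IsMaximalVertex.isMinimalIn_neg (hl : F.IsLabelling l) (hb : F.IsMaximalVertex b) {t : ℕ}
    (ht : Fintype.card V ≤ t) : IsMinimalIn F.graph (-l) b t := by
  obtain ⟨φ, hφ⟩ := hb
  have hcopy : IsCopy F.graph l (maxLabel _) φ.toCopy := φ.isCopy hl fun _ _ h => h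
  have hrev : maxLabel (Fintype.card V) =
      (maxLabel _ ∘ Sym2.map Fin.rev) ∘ Sym2.map Fin.rev := by
    funext e
    simp [Sym2.map_map]
  rw [hrev] at hcopy
  exact (hcopy.comp Fin.rev_injective).neg.isMinimalIn ht (orderedByMin_neg_maxLabel_rev _)
    (rowsIncreasing_neg_maxLabel_rev _) fun v => Fin.rev_le_rev.2 (Fin.le_def.2 (by omega))

end Orderings

section Homogeneity

variable {I : Type*} {J : Type*} [LinearOrder I] [LinearOrder J] {r R n : ℕ}
  {c : Sym2 (WithTop I) → ℤ}

/-- How two edges spanned by `⊤` and at most `R` vertices from `I` compare depends only on the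
relative order of these vertices. The vertex `⊤` stands for a vertex that has to be covered. -/
def IsHomogeneous (R : ℕ) (c : Sym2 (WithTop I) → ℤ) : Prop :=
  ∀ r ≤ R, ∀ (f g : Fin r ↪o I) (e e' : Sym2 (WithTop (Fin r))),
    c (e.map (WithTop.map f)) < c (e'.map (WithTop.map f)) ↔
      c (e.map (WithTop.map g)) < c (e'.map (WithTop.map g))

theorem IsHomogeneous.comp (h : IsHomogeneous R c) (q : J ↪o I) :
    IsHomogeneous R (c ∘ Sym2.map (WithTop.map q)) := by
  intro r hr f g e e'
  simpa [Sym2.map_map, WithTop.map_comp_map] using h r hr (f.trans q) (g.trans q) e e'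

theorem IsHomogeneous.neg (h : IsHomogeneous R c) : IsHomogeneous R (-c) := by
  intro r hr f g e e'
  simpa using h r hr f g e' e

theorem IsHomogeneous.rev {c : Sym2 (WithTop (Fin n)) → ℤ} (h : IsHomogeneous R c) :
    IsHomogeneous R (c ∘ Sym2.map (WithTop.map Fin.rev)) := by
  intro r hr f g e e'
  let conj (f : Fin r ↪o Fin n) : Fin r ↪o Fin n :=
    .ofStrictMono (Fin.rev ∘ f ∘ Fin.rev) fun i j hij =>
      Fin.rev_lt_rev.2 (f.strictMono (Fin.rev_lt_rev.2 hij))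
  have hconj (f : Fin r ↪o Fin n) : conj f ∘ Fin.rev = Fin.rev ∘ f := by
    funext i
    exact congrArg (Fin.rev ∘ f) i.rev_rev
  simpa [Sym2.map_map, WithTop.map_comp_map, hconj] using
    h r hr (conj f) (conj g) (e.map (WithTop.map Fin.rev)) (e'.map (WithTop.map Fin.rev))

theorem exists_isHomogeneous (R n : ℕ) : ∃ N, ∀ c : Sym2 (WithTop (Fin N)) → ℤ,
    ∃ q : Fin n ↪o Fin N, IsHomogeneous R (c ∘ Sym2.map (WithTop.map q)) := by
  induction R generalizing n with
  | zero =>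
    refine ⟨n, fun c => ⟨.refl _, fun r hr f g e e' => ?_⟩⟩
    obtain rfl := Nat.le_zero.1 hr
    rw [show f = g from DFunLike.ext _ _ fun i => i.elim0]
  | succ R ih =>
    -- The colour of an `(R + 1)`-set records the order of all the edges that it spans with `⊤`.
    obtain ⟨M, hM⟩ := exists_orderEmb_monochromatic
      (Sym2 (WithTop (Fin (R + 1))) → Sym2 (WithTop (Fin (R + 1))) → Prop) (R + 1) n
    obtain ⟨N, hN⟩ := ih M
    refine ⟨N, fun c => ?_⟩
    obtain ⟨p, hp⟩ := hN c
    obtain ⟨q, hq⟩ := hM fun f e e' =>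
      c (e.map (WithTop.map (f.trans p))) < c (e'.map (WithTop.map (f.trans p)))
    refine ⟨q.trans p, fun r hr f g e e' => ?_⟩
    obtain hr | rfl := hr.lt_or_eq
    · simpa [Sym2.map_map, WithTop.map_comp_map, comp_assoc] using
        hp.comp q r (Nat.lt_succ_iff.1 hr) f g e e'
    · simpa [Sym2.map_map, WithTop.map_comp_map, comp_assoc] using congrFun₂ (hq f g) e e'

theorem IsHomogeneous.lt_or_gt (h : IsHomogeneous R c) (hc : Injective c) (hr : r ≤ R)
    {e e' : Sym2 (WithTop (Fin r))} (hne : e ≠ e') :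
    (∀ f : Fin r ↪o I, c (e.map (WithTop.map f)) < c (e'.map (WithTop.map f))) ∨
      ∀ f : Fin r ↪o I, c (e'.map (WithTop.map f)) < c (e.map (WithTop.map f)) := by
  by_cases! hex : ∃ f : Fin r ↪o I, c (e.map (WithTop.map f)) < c (e'.map (WithTop.map f))
  · obtain ⟨f, hf⟩ := hex
    exact .inl fun g => (h r hr f g e e').1 hf
  · refine .inr fun f => (hex f).lt_of_ne fun heq => hne ?_
    exact (Sym2.map.injective (WithTop.map_injective f.injective) (hc heq)).symm

theorem IsHomogeneous.pair_lt_or_gt (h : IsHomogeneous 4 c) (hc : Injective c)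
    {e e' : Sym2 (WithTop (Fin 2))} (hne : e ≠ e') :
    (∀ ⦃i j : I⦄, i < j → c (e.map (WithTop.map ![i, j])) < c (e'.map (WithTop.map ![i, j]))) ∨
      ∀ ⦃i j : I⦄, i < j → c (e'.map (WithTop.map ![i, j])) < c (e.map (WithTop.map ![i, j])) := by
  have hf {i j : I} (hij : i < j) : StrictMono ![i, j] := by simp [*]
  exact (h.lt_or_gt hc (by norm_num) hne).imp (fun h i j hij => h (.ofStrictMono _ (hf hij)))
    fun h i j hij => h (.ofStrictMono _ (hf hij))

theorem IsHomogeneous.triple_lt_or_gt (h : IsHomogeneous 4 c) (hc : Injective c)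
    {e e' : Sym2 (WithTop (Fin 3))} (hne : e ≠ e') :
    (∀ ⦃i j k : I⦄, i < j → j < k →
      c (e.map (WithTop.map ![i, j, k])) < c (e'.map (WithTop.map ![i, j, k]))) ∨
    ∀ ⦃i j k : I⦄, i < j → j < k →
      c (e'.map (WithTop.map ![i, j, k])) < c (e.map (WithTop.map ![i, j, k])) := by
  have hf {i j k : I} (hij : i < j) (hjk : j < k) : StrictMono ![i, j, k] := by simp [*]
  exact (h.lt_or_gt hc (by norm_num) hne).imp
    (fun h i j k hij hjk => h (.ofStrictMono _ (hf hij hjk)))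
    fun h i j k hij hjk => h (.ofStrictMono _ (hf hij hjk))

theorem IsHomogeneous.quadruple_lt_or_gt (h : IsHomogeneous 4 c) (hc : Injective c)
    {e e' : Sym2 (WithTop (Fin 4))} (hne : e ≠ e') :
    (∀ ⦃i j k m : I⦄, i < j → j < k → k < m →
      c (e.map (WithTop.map ![i, j, k, m])) < c (e'.map (WithTop.map ![i, j, k, m]))) ∨
    ∀ ⦃i j k m : I⦄, i < j → j < k → k < m →
      c (e'.map (WithTop.map ![i, j, k, m])) < c (e.map (WithTop.map ![i, j, k, m])) := by
  have hf {i j k m : I} (hij : i < j) (hjk : j < k) (hkm : k < m) : StrictMono ![i, j, k, m] := by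
    simp [*]
  exact (h.lt_or_gt hc le_rfl hne).imp
    (fun h i j k m hij hjk hkm => h (.ofStrictMono _ (hf hij hjk hkm)))
    fun h i j k m hij hjk hkm => h (.ofStrictMono _ (hf hij hjk hkm))

end Homogeneity

section Canonical

variable {I : Type*} [LinearOrder I] {n : ℕ} {c : Sym2 (WithTop I) → ℤ}

/-- The labelling of the pairs of vertices other than `⊤`. -/
abbrev belowTop (c : Sym2 (WithTop I) → ℤ) : Sym2 I → ℤ :=
  c ∘ Sym2.map WithTop.some

/-- Along a path with increasing vertices the edges increase. -/
def PathsIncreasing (c : Sym2 I → ℤ) : Prop :=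
  ∀ ⦃i j k : I⦄, i < j → j < k → c s(i, j) < c s(j, k)

theorem IsHomogeneous.pathsIncreasing_or_neg (h : IsHomogeneous 4 c) (hc : Injective c) :
    PathsIncreasing (belowTop c) ∨ PathsIncreasing (belowTop (-c)) :=
  (h.triple_lt_or_gt hc (e := s(↑(0 : Fin 3), ↑(1 : Fin 3))) (e' := s(↑(1 : Fin 3), ↑(2 : Fin 3)))
    (by decide)).imp_right fun h _ _ _ hij hjk => neg_lt_neg (h hij hjk)

theorem IsHomogeneous.rowsIncreasing_or_neg (h : IsHomogeneous 4 c) (hc : Injective c) :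
    RowsIncreasing (belowTop c) ∨ RowsIncreasing (belowTop (-c)) :=
  (h.triple_lt_or_gt hc (e := s(↑(0 : Fin 3), ↑(1 : Fin 3))) (e' := s(↑(0 : Fin 3), ↑(2 : Fin 3)))
    (by decide)).imp_right fun h _ _ _ hij hjk => neg_lt_neg (h hij hjk)

theorem IsHomogeneous.orderedByMin_of_nested (h : IsHomogeneous 4 c) (hc : Injective c)
    (g : Fin 6 ↪o I) (hpath : PathsIncreasing (belowTop c))
    (hnest : ∀ ⦃i j k m : I⦄, i < j → j < k → k < m → belowTop c s(i, m) < belowTop c s(j, k)) :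
    OrderedByMin (belowTop c) := by
  have hg {i j : Fin 6} (hij : i < j) : g i < g j := g.strictMono hij
  -- By homogeneity it suffices to compare two edges of each kind. These are chosen such that a
  -- nested pair followed by steps along a path leads from one to the other.
  have hcolumn : ∀ ⦃i j k : I⦄, i < j → j < k → belowTop c s(i, k) < belowTop c s(j, k) := by
    obtain hlt | hgt := h.triple_lt_or_gt hc (e := s(↑(0 : Fin 3), ↑(2 : Fin 3)))
      (e' := s(↑(1 : Fin 3), ↑(2 : Fin 3))) (by decide)
    · exact hlt
    · have hchain := calc belowTop c s(g 0, g 5)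
        _ < belowTop c s(g 1, g 2) := hnest (hg (by decide)) (hg (by decide)) (hg (by decide))
        _ < belowTop c s(g 2, g 4) := hpath (hg (by decide)) (hg (by decide))
        _ < belowTop c s(g 4, g 5) := hpath (hg (by decide)) (hg (by decide))
      exact absurd hchain (hgt (hg (by decide)) (hg (by decide))).not_gt
  have hcrossing : ∀ ⦃i j k m : I⦄, i < j → j < k → k < m →
      belowTop c s(i, k) < belowTop c s(j, m) := by
    obtain hlt | hgt := h.quadruple_lt_or_gt hc (e := s(↑(0 : Fin 4), ↑(2 : Fin 4)))
      (e' := s(↑(1 : Fin 4), ↑(3 : Fin 4))) (by decide)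
    · exact hlt
    · have hchain := calc belowTop c s(g 0, g 4)
        _ < belowTop c s(g 1, g 2) := hnest (hg (by decide)) (hg (by decide)) (hg (by decide))
        _ < belowTop c s(g 2, g 3) := hpath (hg (by decide)) (hg (by decide))
        _ < belowTop c s(g 3, g 5) := hpath (hg (by decide)) (hg (by decide))
      exact absurd hchain (hgt (hg (by decide)) (hg (by decide)) (hg (by decide))).not_gt
  intro i j k m hij hkm hik
  obtain hjk | rfl | hkj := lt_trichotomy j k
  · exact (hpath hij hjk).trans (hpath hjk hkm)
  · exact hpath hij hkm
  · obtain hjm | rfl | hmj := lt_trichotomy j m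
    exacts [hcrossing hik hkj hjm, hcolumn hik hkm, hnest hik hkm hmj]

theorem IsHomogeneous.orderedByMin_or_neg_rev {c : Sym2 (WithTop (Fin n)) → ℤ}
    (h : IsHomogeneous 4 c) (hc : Injective c) (hn : 6 ≤ n)
    (hpath : PathsIncreasing (belowTop c)) :
    OrderedByMin (belowTop c) ∨
      OrderedByMin (belowTop (-(c ∘ Sym2.map (WithTop.map Fin.rev)))) := by
  have hrev := (Sym2.map.injective (WithTop.map_injective (Fin.rev_injective (n := n))))
  obtain hnest | hnest := h.quadruple_lt_or_gt hc (e := s(↑(0 : Fin 4), ↑(3 : Fin 4)))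
    (e' := s(↑(1 : Fin 4), ↑(2 : Fin 4))) (by decide)
  · exact .inl (h.orderedByMin_of_nested hc (Fin.castLEOrderEmb hn) hpath hnest)
  · refine .inr (h.rev.neg.orderedByMin_of_nested (neg_injective.comp (hc.comp hrev))
      (Fin.castLEOrderEmb hn) ?_ ?_)
    · intro i j k hij hjk
      simpa [Sym2.eq_swap] using hpath (Fin.rev_lt_rev.2 hjk) (Fin.rev_lt_rev.2 hij)
    · intro i j k m hij hjk hkm
      simpa [Sym2.eq_swap] using
        hnest (Fin.rev_lt_rev.2 hkm) (Fin.rev_lt_rev.2 hjk) (Fin.rev_lt_rev.2 hij)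

end Canonical

section Core

variable {V : Type*} {I : Type*} [LinearOrder I] {G : SimpleGraph V}
  {l : Sym2 V → ℤ} {a b : V} {t : ℕ} {c : Sym2 (WithTop I) → ℤ} {φ : V → Fin t}

/-- The properties of an edge-ordered graph, given by `G` and `l`, which produce copies with pendant
edges at `a` and `b`: it is Turánable, as witnessed by `K_t`, the vertices `a` and `b` can be placed
extremally in the min and the max ordering, and they lie on a smallest and a largest edge. -/
structure IsSeed (G : SimpleGraph V) (l : Sym2 V → ℤ) (a b : V) (t : ℕ) : Prop where
  injective : Injective l
  exists_isCopy : ∀ c : Sym2 (Fin t) → ℤ, Injective c → ∃ φ, IsCopy G l c φ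
  isMinimalIn : IsMinimalIn G l a t
  isMinimalIn_neg : IsMinimalIn G (-l) b t
  exists_least_edge : ∃ w, G.Adj a w ∧ ∀ e ∈ G.edgeSet, l s(a, w) ≤ l e
  exists_greatest_edge : ∃ w, G.Adj b w ∧ ∀ e ∈ G.edgeSet, l e ≤ l s(b, w)

theorem IsSeed.neg (hs : IsSeed G l a b t) : IsSeed G (-l) b a t where
  injective := neg_injective.comp hs.injective
  exists_isCopy c hc := by
    obtain ⟨φ, hφ⟩ := hs.exists_isCopy (-c) (neg_injective.comp hc)
    exact ⟨φ, neg_neg c ▸ hφ.neg⟩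
  isMinimalIn := hs.isMinimalIn_neg
  isMinimalIn_neg := (neg_neg l).symm ▸ hs.isMinimalIn
  exists_least_edge := by simpa using hs.exists_greatest_edge
  exists_greatest_edge := by simpa using hs.exists_least_edge

/-- The vertices in `I` used for copies: each `v : Fin t` has five consecutive slots, of which the
middle one is for a vertex of the copy and the others are for new neighbours of this vertex. -/
def slot (σ : Fin t ×ₗ Fin 5 ↪o I) (v : Fin t) (s : Fin 5) : I :=
  σ (toLex (v, s))

/-- The middle slot at `v`. -/
def place (σ : Fin t ×ₗ Fin 5 ↪o I) (v : Fin t) : WithTop I :=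
  ↑(slot σ v 2)

variable {σ : Fin t ×ₗ Fin 5 ↪o I} {v w : Fin t} {s s' s₁ s₂ : Fin 5}

theorem slot_inj : slot σ v s = slot σ w s' ↔ v = w ∧ s = s' := by
  simp [slot]

theorem slot_lt_slot_of_lt (h : v < w) : slot σ v s < slot σ w s' := by
  simp [slot, Prod.Lex.toLex_lt_toLex, h]

theorem slot_lt_slot (hvw : v ≤ w) (hs : s < s') : slot σ v s < slot σ w s' := by
  simpa [slot, Prod.Lex.toLex_lt_toLex, hs, ← le_iff_lt_or_eq]

theorem strictMono_place (σ : Fin t ×ₗ Fin 5 ↪o I) : StrictMono (place σ) :=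
  fun _ _ h => WithTop.coe_lt_coe.2 (slot_lt_slot_of_lt h)

theorem top_notMem_range_place : ⊤ ∉ Set.range (place σ ∘ φ) := by
  rintro ⟨v, hv⟩
  exact WithTop.coe_ne_top hv

theorem slot_notMem_range_place (hs : s ≠ 2) : ↑(slot σ v s) ∉ Set.range (place σ ∘ φ) := by
  rintro ⟨w, hw⟩
  exact hs (slot_inj.1 (WithTop.coe_injective hw)).2.symm

theorem IsSeed.exists_isCopy_place (hs : IsSeed G l a b t) (hc : Injective c)
    (σ : Fin t ×ₗ Fin 5 ↪o I) : ∃ φ : V → Fin t, IsCopy G l c (place σ ∘ φ) := by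
  have hinj := (strictMono_place σ).injective
  obtain ⟨φ, hφ⟩ := hs.exists_isCopy _ (hc.comp (Sym2.map.injective hinj))
  exact ⟨φ, hφ.comp hinj⟩

theorem IsCopy.exists_map_place_eq (hφ : IsCopy G l c (place σ ∘ φ)) {e : Sym2 V}
    (he : e ∈ G.edgeSet) :
    ∃ v w, v ∈ Set.range φ ∧ v < w ∧ e.map (place σ ∘ φ) = s(place σ v, place σ w) := by
  obtain ⟨v, w, hvw, hmap⟩ :=
    exists_lt_eq_mk (not_isDiag_map hφ.injective.of_comp (G.not_isDiag_of_mem_edgeSet he))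
  obtain ⟨x, -, hx⟩ := Sym2.mem_map.1 (hmap ▸ Sym2.mem_mk_left v w)
  exact ⟨v, w, ⟨x, hx⟩, hvw, by rw [← Sym2.map_map, hmap, Sym2.map_mk]⟩

theorem IsSeed.exists_low (hs : IsSeed G l a b t)
    (hlex : IsLexicographic (belowTop c)) (hφ : IsCopy G l c (place σ ∘ φ)) (hs₁ : s₁ < 2)
    (hs₂ : 2 < s₂) :
    ∃ v s, (s = s₁ ∨ s = s₂) ∧
      ∀ e ∈ G.edgeSet, c s(↑(slot σ v s), place σ (φ a)) < c (e.map (place σ ∘ φ)) := by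
  obtain ⟨w, haw, hle⟩ := hs.exists_least_edge
  have hle' (e) (he : e ∈ G.edgeSet) :
      c s(place σ (φ w), place σ (φ a)) ≤ c (e.map (place σ ∘ φ)) := by
    rw [Sym2.eq_swap]
    exact hφ.map_le_map hs.injective haw he (hle e he)
  have hne : φ a ≠ φ w := hφ.injective.of_comp.ne haw.ne
  obtain h | h := hlex.exists_neighbour_lt (slot_lt_slot (σ := σ) (le_refl (φ w)) hs₁)
    (slot_lt_slot le_rfl hs₂) (hne.lt_or_gt.imp slot_lt_slot_of_lt slot_lt_slot_of_lt)
  · exact ⟨φ w, s₁, .inl rfl, fun e he => h.trans_le (hle' e he)⟩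
  · exact ⟨φ w, s₂, .inr rfl, fun e he => h.trans_le (hle' e he)⟩

theorem IsSeed.exists_high (hs : IsSeed G l a b t)
    (hlex : IsLexicographic (belowTop c)) (hφ : IsCopy G l c (place σ ∘ φ)) (hs₁ : s₁ < 2)
    (hs₂ : 2 < s₂) :
    ∃ v s, (s = s₁ ∨ s = s₂) ∧
      ∀ e ∈ G.edgeSet, c (e.map (place σ ∘ φ)) < c s(↑(slot σ v s), place σ (φ b)) := by
  obtain ⟨v, s, hvs, h⟩ := hs.neg.exists_low hlex.neg hφ.neg hs₁ hs₂
  exact ⟨v, s, hvs, fun e he => neg_lt_neg_iff.1 (h e he)⟩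

theorem IsSeed.hasPendantCopyThrough_of_low (hs : IsSeed G l a b t)
    (hlex : IsLexicographic (belowTop c)) (hφ : IsCopy G l c (place σ ∘ φ))
    (hlow : ∀ e ∈ G.edgeSet, c s(⊤, place σ (φ a)) < c (e.map (place σ ∘ φ))) :
    HasPendantCopyThrough G l a b c ⊤ := by
  obtain ⟨v, s, hvs, hhigh⟩ := hs.exists_high hlex hφ (s₁ := 1) (s₂ := 3) (by decide) (by decide)
  have hs2 : s ≠ 2 := by rintro rfl; simp at hvs
  exact ⟨_, hφ.isPendantCopy top_notMem_range_place (slot_notMem_range_place hs2)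
    (WithTop.top_ne_coe) hlow hhigh, .inr false, rfl⟩

theorem IsSeed.hasPendantCopyThrough_of_high (hs : IsSeed G l a b t)
    (hlex : IsLexicographic (belowTop c)) (hφ : IsCopy G l c (place σ ∘ φ))
    (hhigh : ∀ e ∈ G.edgeSet, c (e.map (place σ ∘ φ)) < c s(⊤, place σ (φ b))) :
    HasPendantCopyThrough G l a b c ⊤ := by
  have h := hs.neg.hasPendantCopyThrough_of_low hlex.neg hφ.neg fun e he => neg_lt_neg (hhigh e he)
  simpa using h.neg

theorem IsSeed.exists_isPendantCopy (hs : IsSeed G l a b t) (hc : Injective c)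
    (hlex : IsLexicographic (belowTop c)) (σ : Fin t ×ₗ Fin 5 ↪o I) :
    ∃ ψ, IsPendantCopy G l a b c ψ := by
  obtain ⟨φ, hφ⟩ := hs.exists_isCopy_place hc σ
  obtain ⟨v, s, hvs, hlow⟩ := hs.exists_low hlex hφ (s₁ := 1) (s₂ := 3) (by decide) (by decide)
  obtain ⟨w, s', hws, hhigh⟩ := hs.exists_high hlex hφ (s₁ := 0) (s₂ := 4) (by decide) (by decide)
  have hs2 : s ≠ 2 ∧ s' ≠ 2 ∧ s ≠ s' := by
    obtain ⟨rfl | rfl, rfl | rfl⟩ := And.intro hvs hws <;> decide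
  exact ⟨_, hφ.isPendantCopy (slot_notMem_range_place hs2.1) (slot_notMem_range_place hs2.2.1)
    (fun h => hs2.2.2 (slot_inj.1 (WithTop.coe_injective h)).2) hlow hhigh⟩

end Core

section Cases

variable {V : Type*} {I : Type*} {J : Type*} [LinearOrder I] [LinearOrder J]
  {G : SimpleGraph V} {l : Sym2 V → ℤ} {a b : V} {t : ℕ} {c : Sym2 (WithTop I) → ℤ}

theorem IsSeed.hasPendantCopyThrough_top_of_lt (hs : IsSeed G l a b t) (hc : Injective c)
    (σ : Fin t ×ₗ Fin 5 ↪o I) (hmin : OrderedByMin (belowTop c))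
    (hlex : IsLexicographic (belowTop c))
    (htop : ∀ ⦃i j k : I⦄, i < j → j < k → c s(⊤, ↑k) < c s(↑i, ↑j)) :
    HasPendantCopyThrough G l a b c ⊤ := by
  obtain ⟨φ, hφ⟩ := hs.exists_isCopy_place hc σ
  refine hs.hasPendantCopyThrough_of_low hlex hφ fun e he => ?_
  obtain ⟨v, w, -, hvw, hmap⟩ := hφ.exists_map_place_eq he
  let m := min (φ a) v
  rw [hmap]
  calc c s(⊤, place σ (φ a))
      < c s(↑(slot σ m 0), ↑(slot σ m 1)) :=
        htop (slot_lt_slot le_rfl (by decide)) (slot_lt_slot (min_le_left _ _) (by decide))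
    _ < c s(place σ v, place σ w) :=
        hmin (slot_lt_slot le_rfl (by decide)) (slot_lt_slot_of_lt hvw)
          (slot_lt_slot (min_le_right _ _) (by decide))

theorem IsSeed.hasPendantCopyThrough_top_of_gt (hs : IsSeed G l a b t) (hc : Injective c)
    (σ : Fin t ×ₗ Fin 5 ↪o I) (hmin : OrderedByMin (belowTop c))
    (hlex : IsLexicographic (belowTop c))
    (htop : ∀ ⦃i j k : I⦄, i < j → j < k → c s(↑j, ↑k) < c s(⊤, ↑i)) :
    HasPendantCopyThrough G l a b c ⊤ := by
  obtain ⟨φ, hφ⟩ := hs.exists_isCopy_place hc σ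
  refine hs.hasPendantCopyThrough_of_high hlex hφ fun e he => ?_
  obtain ⟨v, w, -, hvw, hmap⟩ := hφ.exists_map_place_eq he
  let m := max (φ b) v
  rw [hmap]
  calc c s(place σ v, place σ w)
      < c s(↑(slot σ m 3), ↑(slot σ m 4)) :=
        hmin (slot_lt_slot_of_lt hvw) (slot_lt_slot le_rfl (by decide))
          (slot_lt_slot (le_max_right _ _) (by decide))
    _ < c s(⊤, place σ (φ b)) :=
        htop (slot_lt_slot (le_max_left _ _) (by decide)) (slot_lt_slot le_rfl (by decide))

theorem IsHomogeneous.orderedByMin (h : IsHomogeneous 4 c) (hc : Injective c) (g : Fin 6 ↪o I)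
    (hmin : OrderedByMin (belowTop c))
    (hlt : ∀ ⦃i j k : I⦄, i < j → j < k → c s(↑i, ↑j) < c s(⊤, ↑k))
    (hgt : ∀ ⦃i j k : I⦄, i < j → j < k → c s(⊤, ↑i) < c s(↑j, ↑k)) : OrderedByMin c := by
  have hg {i j : Fin 6} (hij : i < j) : g i < g j := g.strictMono hij
  have hrow {m : Fin 6} (hm : 3 ≤ m) : c s(↑(g 0), ↑(g m)) < c s(⊤, ↑(g 3)) := calc
    _ < c s(↑(g 1), ↑(g 2)) := hmin (hg (by omega)) (hg (by decide)) (hg (by decide))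
    _ < c s(⊤, ↑(g 3)) := hlt (hg (by decide)) (hg (by decide))
  have hlonger : ∀ ⦃i j k : I⦄, i < j → j < k → c s(↑i, ↑k) < c s(⊤, ↑j) :=
    (h.triple_lt_or_gt hc (e := s(↑(0 : Fin 3), ↑(2 : Fin 3))) (e' := s(⊤, ↑(1 : Fin 3)))
      (by decide)).resolve_right fun h =>
        (h (hg (by decide)) (hg (by decide))).not_gt (hrow (m := 4) (by decide))
  have hequal : ∀ ⦃i j : I⦄, i < j → c s(↑i, ↑j) < c s(⊤, ↑j) :=
    (h.pair_lt_or_gt hc (e := s(↑(0 : Fin 2), ↑(1 : Fin 2))) (e' := s(⊤, ↑(1 : Fin 2)))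
      (by decide)).resolve_right fun h => (h (hg (by decide))).not_gt (hrow le_rfl)
  have htop : ∀ ⦃i j : I⦄, i < j → c s(⊤, ↑i) < c s(⊤, ↑j) :=
    (h.pair_lt_or_gt hc (e := s(⊤, ↑(0 : Fin 2))) (e' := s(⊤, ↑(1 : Fin 2)))
      (by decide)).resolve_right fun h => (h (hg (by decide : (0 : Fin 6) < 3))).not_gt <|
        (hgt (hg (by decide)) (hg (by decide : (1 : Fin 6) < 2))).trans
          (hlt (hg (by decide)) (hg (by decide)))
  intro i j k m hij hkm hik
  lift i to I using ne_top_of_lt hij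
  lift k to I using ne_top_of_lt hkm
  rw [WithTop.coe_lt_coe] at hik
  obtain rfl | hj := eq_or_ne j ⊤ <;> obtain rfl | hm := eq_or_ne m ⊤
  · simpa only [Sym2.eq_swap] using htop hik
  · lift m to I using hm
    simpa only [Sym2.eq_swap] using hgt hik (WithTop.coe_lt_coe.1 hkm)
  · lift j to I using hj
    rw [WithTop.coe_lt_coe] at hij
    rw [Sym2.eq_swap (a := (k : WithTop I))]
    obtain hjk | rfl | hkj := lt_trichotomy j k
    exacts [hlt hij hjk, hequal hij, hlonger hik hkj]
  · lift j to I using hj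
    lift m to I using hm
    exact hmin (WithTop.coe_lt_coe.1 hij) (WithTop.coe_lt_coe.1 hkm) hik

theorem IsPendantCopy.hasPendantCopyThrough_top [Finite V] [OrderTop J] {c : Sym2 J → ℤ}
    (hmin : OrderedByMin c) (hrow : RowsIncreasing (-c)) {ψ : V ⊕ Bool → J}
    (hψ : IsPendantCopy G l a b c ψ) : HasPendantCopyThrough G l a b c ⊤ := by
  obtain ⟨y, hy⟩ := Finite.exists_max ψ
  -- Replacing the last vertex of the copy by `⊤` does not change the order of the edges.
  let q (w : Set.range ψ) : J := if w = ψ y then ⊤ else w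
  have hval : StrictMono ((↑) : Set.range ψ → J) := Subtype.strictMono_coe _
  have hq : StrictMono q := by
    rintro ⟨_, v, rfl⟩ ⟨_, w, rfl⟩ (hvw : ψ v < ψ w)
    simp only [q, (hvw.trans_le (hy w)).ne, if_false]
    split_ifs
    exacts [hvw.trans_le le_top, hvw]
  have hrows {p : Set.range ψ → J} (hp : StrictMono p) {i j k : Set.range ψ} (hij : i < j)
      (hik : i < k) : c s(p i, p j) < c s(p i, p k) ↔ k < j :=
    neg_lt_neg_iff.symm.trans ((hrow.comp hp).lt_iff_lt hik hij)
  have hsame : SameEdgeOrder (c ∘ Sym2.map (↑)) (c ∘ Sym2.map q) :=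
    (hmin.comp hval).sameEdgeOrder (hmin.comp hq) fun i j k hij hik =>
      (hrows hval hij hik).trans (hrows hq hij hik).symm
  have hψ' : IsPendantCopy G l a b (c ∘ Sym2.map (↑)) (Set.rangeFactorization ψ) := .of_comp hψ
  exact ⟨_, (hsame.isPendantCopy hψ').comp hq.injective, y, if_pos rfl⟩

theorem IsSeed.hasPendantCopyThrough_top_of_rows_lt (hs : IsSeed G l a b t) (hc : Injective c)
    (σ : Fin t ×ₗ Fin 5 ↪o I) (hmin : OrderedByMin c) (hlex : IsLexicographic (belowTop c))
    (htop : ∀ ⦃i j : I⦄, i < j → c s(↑i, ↑j) < c s(⊤, ↑i)) :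
    HasPendantCopyThrough G l a b c ⊤ := by
  obtain ⟨φ, hφ⟩ := hs.exists_isCopy_place hc σ
  obtain ⟨w, hbw, hle⟩ := hs.exists_greatest_edge
  refine hs.hasPendantCopyThrough_of_high hlex hφ fun e he =>
    (hφ.map_le_map hs.injective he hbw (hle e he)).trans_lt ?_
  have hmono := strictMono_place σ
  change c s(place σ (φ b), place σ (φ w)) < _
  obtain hlt | hgt := (hφ.injective.of_comp.ne hbw.ne).lt_or_gt
  · exact htop (slot_lt_slot_of_lt hlt)
  · rw [Sym2.eq_swap, Sym2.eq_swap (a := ⊤)]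
    exact hmin (hmono hgt) (WithTop.coe_lt_top _) (hmono hgt)

theorem IsSeed.hasPendantCopyThrough_top_of_isMinimalIn (hs : IsSeed G l a b t)
    (σ : Fin t ×ₗ Fin 5 ↪o I) (hmin : OrderedByMin c) (hlex : IsLexicographic (belowTop c))
    (hrow : RowsIncreasing (belowTop c))
    (htop : ∀ ⦃i j : I⦄, i < j → c s(⊤, ↑i) < c s(↑i, ↑j)) :
    HasPendantCopyThrough G l a b c ⊤ := by
  obtain ⟨φ, hφ, ha⟩ := hs.isMinimalIn
  have hmono := strictMono_place σ
  have hsame : SameEdgeOrder (minLabel t) (c ∘ Sym2.map (place σ)) :=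
    (orderedByMin_minLabel t).sameEdgeOrder (hmin.comp hmono) fun i j k hij hik =>
      ((rowsIncreasing_minLabel t).lt_iff_lt hij hik).trans
        ((hrow.comp fun _ _ => slot_lt_slot_of_lt).lt_iff_lt hij hik).symm
  have hφ' := (hsame.isCopy hφ).comp hmono.injective
  refine hs.hasPendantCopyThrough_of_low hlex hφ' fun e he => ?_
  obtain ⟨v, w, ⟨x, rfl⟩, hvw, hmap⟩ := hφ'.exists_map_place_eq he
  rw [hmap]
  obtain hax | hax := (ha x).lt_or_eq
  · rw [Sym2.eq_swap]
    exact hmin (WithTop.coe_lt_top _) (hmono hvw) (hmono hax)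
  · rw [hax]
    exact htop (slot_lt_slot_of_lt hvw)

theorem IsSeed.hasPendantCopyThrough_top_of_orderedByMin [Finite V] (hs : IsSeed G l a b t)
    (hhom : IsHomogeneous 4 c) (hc : Injective c) (σ : Fin t ×ₗ Fin 5 ↪o I) (g : Fin 6 ↪o I)
    (hmin : OrderedByMin (belowTop c)) : HasPendantCopyThrough G l a b c ⊤ := by
  have hlex : IsLexicographic (belowTop c) := ⟨.inl hmin, hhom.rowsIncreasing_or_neg hc⟩
  obtain h₁ | h₁ := hhom.triple_lt_or_gt hc (e := s(⊤, ↑(2 : Fin 3)))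
    (e' := s(↑(0 : Fin 3), ↑(1 : Fin 3))) (by decide)
  · exact hs.hasPendantCopyThrough_top_of_lt hc σ hmin hlex h₁
  obtain h₂ | h₂ := hhom.triple_lt_or_gt hc (e := s(↑(1 : Fin 3), ↑(2 : Fin 3)))
    (e' := s(⊤, ↑(0 : Fin 3))) (by decide)
  · exact hs.hasPendantCopyThrough_top_of_gt hc σ hmin hlex h₂
  replace hmin : OrderedByMin c := hhom.orderedByMin hc g hmin h₁ h₂
  obtain h₃ | h₃ := hhom.pair_lt_or_gt hc (e := s(↑(0 : Fin 2), ↑(1 : Fin 2)))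
    (e' := s(⊤, ↑(0 : Fin 2))) (by decide)
  · exact hs.hasPendantCopyThrough_top_of_rows_lt hc σ hmin hlex h₃
  obtain hrow | hrow := hlex.2
  · exact hs.hasPendantCopyThrough_top_of_isMinimalIn σ hmin hlex hrow h₃
  obtain ⟨ψ, hψ⟩ := hs.exists_isPendantCopy hc hlex σ
  refine hψ.hasPendantCopyThrough_top hmin fun i j k hij hjk => ?_
  lift i to I using ne_top_of_lt hij
  lift j to I using ne_top_of_lt hjk
  rw [WithTop.coe_lt_coe] at hij
  obtain rfl | hk := eq_or_ne k ⊤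
  · rw [Sym2.eq_swap (b := ⊤)]
    exact neg_lt_neg (h₃ hij)
  · lift k to I using hk
    exact hrow hij (WithTop.coe_lt_coe.1 hjk)

end Cases

section PendantCopies

variable {V : Type*} {F : EdgeOrderedGraph V} {G : SimpleGraph V} {l : Sym2 V → ℤ}
  {a b : V} {n t : ℕ}

theorem exists_lex_orderEmb (h : t * 5 ≤ n) : Nonempty (Fin t ×ₗ Fin 5 ↪o Fin n) := by
  have hcard : Fintype.card (Fin t ×ₗ Fin 5) = t * 5 := by simp
  exact ⟨(Fintype.orderIsoFinOfCardEq _ hcard).symm.toOrderEmbedding.trans (Fin.castLEOrderEmb h)⟩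

variable [Finite V] {c : Sym2 (WithTop (Fin n)) → ℤ}

theorem IsSeed.hasPendantCopyThrough_top_of_pathsIncreasing (hs : IsSeed G l a b t)
    (hhom : IsHomogeneous 4 c) (hc : Injective c) (hn : 6 ≤ n) (htn : t * 5 ≤ n)
    (hpath : PathsIncreasing (belowTop c)) : HasPendantCopyThrough G l a b c ⊤ := by
  obtain ⟨σ⟩ := exists_lex_orderEmb htn
  let g : Fin 6 ↪o Fin n := Fin.castLEOrderEmb hn
  obtain hmin | hmin := hhom.orderedByMin_or_neg_rev hc hn hpath
  · exact hs.hasPendantCopyThrough_top_of_orderedByMin hhom hc σ g hmin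
  · have hrev := WithTop.map_injective (Fin.rev_injective (n := n))
    have h := (hs.neg.hasPendantCopyThrough_top_of_orderedByMin hhom.rev.neg
      (neg_injective.comp (hc.comp (Sym2.map.injective hrev))) σ g hmin).neg
    rw [neg_neg, neg_neg] at h
    exact h.comp hrev

theorem IsSeed.hasPendantCopyThrough_top (hs : IsSeed G l a b t) (hhom : IsHomogeneous 4 c)
    (hc : Injective c) (hn : 6 ≤ n) (htn : t * 5 ≤ n) : HasPendantCopyThrough G l a b c ⊤ := by
  obtain hpath | hpath := hhom.pathsIncreasing_or_neg hc
  · exact hs.hasPendantCopyThrough_top_of_pathsIncreasing hhom hc hn htn hpath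
  · have h := (hs.neg.hasPendantCopyThrough_top_of_pathsIncreasing hhom.neg
      (neg_injective.comp hc) hn htn hpath).neg
    rwa [neg_neg, neg_neg] at h

theorem IsSeed.exists_forall_exists_isPendantCopy (hs : IsSeed G l a b t) :
    ∃ M, ∀ ⦃W : Type*⦄ (c : Sym2 W → ℤ), Injective c → ∀ (x : W) (S : Finset W), x ∉ S →
      M ≤ S.card →
        ∃ ψ, IsPendantCopy G l a b c ψ ∧ x ∈ Set.range ψ ∧ Set.range ψ ⊆ insert x ↑S := by
  obtain ⟨N, hN⟩ := exists_isHomogeneous 4 (max 6 (t * 5))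
  refine ⟨N, fun W c hc x S hx hS => ?_⟩
  obtain ⟨f⟩ : Nonempty (Fin N ↪ S) := Function.Embedding.nonempty_of_card_le (by simpa)
  let q : WithTop (Fin N) → W := WithTop.recTopCoe x fun i => f i
  have hq : Injective q := by
    refine Option.injective_iff.2 ⟨Subtype.val_injective.comp f.injective, ?_⟩
    rintro ⟨i, hi : ↑(f i) = x⟩
    exact hx (hi ▸ (f i).2)
  have hqS : Set.range q ⊆ insert x ↑S := by
    rintro _ ⟨_ | i, rfl⟩
    exacts [.inl rfl, .inr (f i).2]
  obtain ⟨p, hp⟩ := hN (c ∘ Sym2.map q)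
  have hinj := WithTop.map_injective p.injective
  obtain ⟨ψ, hψ, v, hv⟩ := hs.hasPendantCopyThrough_top hp
    ((hc.comp (Sym2.map.injective hq)).comp (Sym2.map.injective hinj))
    (le_max_left _ _) (le_max_right _ _)
  exact ⟨_, (hψ.comp hinj).comp hq, ⟨v, by simp [hv, q]⟩,
    (Set.range_comp_subset_range _ q).trans hqS⟩

theorem Turanable.exists_isSeed [Fintype V] (hF : F.Turanable) (hl : F.IsLabelling l)
    (ha : F.IsMinimalVertex a) (ha' : ¬F.graph.IsIsolated a) (hb : F.IsMaximalVertex b)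
    (hb' : ¬F.graph.IsIsolated b) : ∃ t, IsSeed F.graph l a b t := by
  obtain ⟨t, ht⟩ := hF.exists_isCopy hl
  have hcast := (Fin.castLE_injective (le_max_left t (Fintype.card V)))
  have hmin := ha.isMinimalIn hl (le_max_right t _)
  have hmax := hb.isMinimalIn_neg hl (le_max_right t _)
  refine ⟨_, hl.injective, fun c hc => ?_, hmin, hmax, hmin.exists_least_edge ha', ?_⟩
  · obtain ⟨φ, hφ⟩ := ht _ (hc.comp (Sym2.map.injective hcast))
    exact ⟨_, hφ.comp hcast⟩
  · simpa using hmax.exists_least_edge hb'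

end PendantCopies

end EdgeOrderedGraph

theorem proposition2p15 {V : Type*} [Fintype V] (F : EdgeOrderedGraph V) (hF : F.Turanable)
    (vmin vmax : V) (hne : vmin ≠ vmax)
    (hmin : F.IsMinimalVertex vmin) (hmin_adj : ¬ F.graph.IsIsolated vmin)
    (hmax : F.IsMaximalVertex vmax) (hmax_adj : ¬ F.graph.IsIsolated vmax) :
    (F.addPendants vmin vmax).Tileable := by
  obtain ⟨l, hl⟩ := F.exists_isLabelling
  obtain ⟨t, hs⟩ := hF.exists_isSeed hl hmin hmin_adj hmax hmax_adj
  obtain ⟨M, hM⟩ := hs.exists_forall_exists_isPendantCopy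
  refine EdgeOrderedGraph.tileable_of_forall_exists_embedding M fun n o x S hx hS => ?_
  obtain ⟨c, hc⟩ := (EdgeOrderedGraph.complete n o).exists_isLabelling
  obtain ⟨ψ, hψ, hxψ, hψS⟩ := hM c hc.injective x S hx hS
  obtain ⟨φ, hφ⟩ := hψ.exists_embedding hl hc hmin_adj
  exact ⟨φ, hφ ▸ hxψ, hφ ▸ hψS⟩
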